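/- **Setting.** Let $\mathcal G_1$ be a consistent brane tiling: a finite connected bipartite graph, embedded in the oriented 2-torus so that all faces are discs, which is properly ordered, i.e. no zig-zag path is homologically trivial, the two zig-zag passages through any edge have windings in different directions, and around each node the zig-zag paths occur in the cyclic order of the directions of their windings. Let $X_I$ be variables indexed by the edges $e_I$, and let $\gamma_x,\gamma_y$ be loops forming a basis of the first homology of the torus; counting signed crossings with them, every perfect matching $q$ gets a lattice point in $\mathbb Z^2$, relative to a fixed reference perfect matching placed at the origin. Assume that the origin is an interior point of the Newton polygon (the convex hull of the lattice points of all perfect matchings). Let $s_1,s_2,\dots$ be the perfect matchings with lattice point $0$ and $r_1,\dots,r_N$ the others, with lattice points $(m_i,n_i)\neq(0,0)$; let $M$ be the $2\times N$ integer matrix with columns $(m_i,n_i)^T$. Using the same letters $r_i$ for arbitrary complex weights of the $r$-matchings, put $$p(z,w)=\sum_{i=1}^N r_i z^{m_i}w^{n_i},\qquad u_0(k)=\frac1{(2\pi i)^2}\int_{|z|=|w|=1}\frac{1}{1-k^{-1}p(z,w)}\frac{dz}{z}\frac{dw}{w}.$$ Let $P$ be the perfect matching matrix (rows: edges, columns: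 perfect matchings, entry $1$ if the edge is in the matching and $0$ otherwise). The F-term charge matrix $Q_F$ is a matrix whose rows form a $\mathbb Z$-basis of the integral kernel of $P$. Let $W=\sum_{v\text{ white}}\prod_{e_I\ni v}X_I-\sum_{v\text{ black}}\prod_{e_I\ni v}X_I$. The master space is $\operatorname{Spec}\mathbb C[X_I]/\langle\partial W\rangle$, and its coherent component is the closure in it of the locus where all $X_I\ne0$ (its ideal is the saturation of $\langle\partial W\rangle$ by $\prod_I X_I$). **Proposition.** The period $u_0(k)$ is a generating function of the master space in terms of the F-term charge matrix, in the following sense. For $n\ge 0$ put $$f_n=\sum_{\substack{\boldsymbol l\in\mathbb Z_{\ge0}^N,\ l_1+\dots+l_N=n\\ M\boldsymbol l=0}}\frac{n!}{l_1!\cdots l_N!}\,r_1^{l_1}\cdots r_N^{l_N}.$$ 1. $f_0=1$, $f_1=0$, and for all complex weights $r_i$ and all $k\in\mathbb C$ with $|k|>\max_{|z|=|w|=1}|p(z,w)|$, $$u_0(k)=1+\sum_{n=2}^\infty\frac{f_n}{k^n}.$$ 2. For each monomial $r_1^{l_1}\cdots r_N^{l_N}$ occurring in $f_n$ there are integers $l'_j\ge0$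 with $\sum_j l'_j=n$ and $\sum_i l_ir_i=\sum_j l'_js_j$ as multisets of edges. 3. The relations $\sum_i l_ir_i=\sum_j l'_js_j$ (with $l'_j\ge 0$, as multisets of edges) coming from the monomials $r^{\boldsymbol l}$ of the coefficients $f_n$, $n\ge0$, regarded as the integer vectors $(\boldsymbol l,-\boldsymbol l')$ indexed by the perfect matchings, generate over $\mathbb Z$ exactly the integral kernel of $P$. So they lie in the row lattice of $Q_F$, and all rows of $Q_F$ are integer combinations of them. 4. The coherent component is an irreducible component of the master space and is the symplectic quotient $\mathbb C[q]/\!/Q$ of the space of GLSM fields by the set $Q$ of charge vectors obtained in 3 from the period: with one variable $q$ for each perfect matching, the homomorphism $\mathbb C[X_I]\to\mathbb C[q]$, $X_I\mapsto\prod_{q\ni e_I}q$, has the ideal of the coherent component as its kernel, and its image is the ring of all polynomials whose monomials $\prod_q q^{a_q}$ satisfy $\sum_q c_qa_q=0$ for every $c\in Q$. -/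

import Mathlib

open scoped Matrix Real

noncomputable section

/-- A connected bipartite graph with (finite) edge set `E`, cellularly embedded in a closed oriented
surface, given by its rotation system: `σW` (resp. `σB`) sends an edge to the next edge in
counterclockwise order around its white (resp. black) endpoint. The white and black nodes are the
cycles of `σW` and `σB`; the faces are the cycles of `σW * σB`, the cycle of `e` being the face
that lies to the right of `e` when `e` is traversed from white to black. -/
structure BipartiteMap (E : Type*) where
  σW : Equiv.Perm E
  σB : Equiv.Perm E
  connected : MulAction.IsPretransitive (Subgroup.closure {σW, σB}) E

namespace BipartiteMap

variable {E : Type*} (G : BipartiteMap E)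

/-- White nodes. -/
def White : Type _ := Quotient (Equiv.Perm.SameCycle.setoid G.σW)

/-- Black nodes. -/
def Black : Type _ := Quotient (Equiv.Perm.SameCycle.setoid G.σB)

/-- The white endpoint of an edge. -/
def white (e : E) : G.White := Quotient.mk (Equiv.Perm.SameCycle.setoid G.σW) e

/-- The black endpoint of an edge. -/
def black (e : E) : G.Black := Quotient.mk (Equiv.Perm.SameCycle.setoid G.σB) e

instance [Finite E] : Finite G.White := inferInstanceAs (Finite (Quotient _))

instance [Finite E] : Finite G.Black := inferInstanceAs (Finite (Quotient _))

instance [Finite E] : Fintype G.White := Fintype.ofFinite _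

instance [Finite E] : Fintype G.Black := Fintype.ofFinite _

/-- Integral functions on the set of faces, as functions on `E` constant along each face. -/
def IsFaceFunction (h : E → ℤ) : Prop := ∀ e, h (G.σW (G.σB e)) = h e

/-- The boundary of the cellular 2-chain with coefficients `h`; all edges are oriented from white
to black. The edge `e` is traversed from white to black by the face of `e`, and from black to white
by the face of `σB⁻¹ e`. -/
def faceBoundary (h : E → ℤ) (e : E) : ℤ := h e - h (G.σB.symm e)

open Classical in
/-- Cellular 1-cycles. -/
def IsOneCycle [Fintype E] (x : E → ℤ) : Prop :=
  (∀ v, ∑ e with G.white e = v, x e = 0) ∧ (∀ v, ∑ e with G.black e = v, x e = 0)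

/-- A set of edges which meets each node exactly once. -/
def IsPerfectMatching (M : Finset E) : Prop :=
  (∀ v, ∃! e, e ∈ M ∧ G.white e = v) ∧ (∀ v, ∃! e, e ∈ M ∧ G.black e = v)

/-- The perfect matchings (GLSM fields). -/
def PerfectMatching : Type _ := {M : Finset E // G.IsPerfectMatching M}

instance [Finite E] : Finite G.PerfectMatching := inferInstanceAs (Finite (Subtype _))

instance [Finite E] : Fintype G.PerfectMatching := Fintype.ofFinite _

/-- The zig-zag step: traverse `e` from white to black, turn maximally left at the black endpoint,
traverse `σB⁻¹ e` from black to white, turn maximally right at its white endpoint. The cycles of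
this permutation are the zig-zag paths. -/
def zigzag : Equiv.Perm E := G.σW * G.σB.symm

end BipartiteMap

/-- A bipartite graph embedded in the 2-torus. The entry `crossing e j` is the exponent of `z` (`j = 0`) or
`w` (`j = 1`) by which the weight of the edge `e` is multiplied, that is, the signed number of
crossings of `e`, oriented from white to black, with the fundamental loop `γ_x` or `γ_y`. That these
loops form a basis of the first homology of the torus is expressed by the last three fields: `crossing`
induces an isomorphism from the first (cellular) homology group of the surface onto `ℤ²`. In
particular the surface has genus one. -/
structure BraneTiling (E : Type*) [Fintype E] extends BipartiteMap E where
  crossing : E → Fin 2 → ℤ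
  boundary_eq_zero : ∀ h, toBipartiteMap.IsFaceFunction h →
    ∑ e, toBipartiteMap.faceBoundary h e • crossing e = 0
  exists_boundary : ∀ x, toBipartiteMap.IsOneCycle x → ∑ e, x e • crossing e = 0 →
    ∃ h, toBipartiteMap.IsFaceFunction h ∧ x = toBipartiteMap.faceBoundary h
  exists_cycle : ∀ v : Fin 2 → ℤ, ∃ x, toBipartiteMap.IsOneCycle x ∧ ∑ e, x e • crossing e = v

namespace BraneTiling

variable {E : Type*} [Fintype E] (T : BraneTiling E)

/-! ### Consistency -/

open Classical in
/-- The winding (homology class) of the zig-zag path that traverses `e` from white to black. The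
zig-zag path that traverses `e` from black to white is the one through `σB e`. -/
def winding (e : E) : Fin 2 → ℤ :=
  ∑ f with T.zigzag.SameCycle e f, (T.crossing f - T.crossing (T.σB.symm f))

/-- The determinant of two planar vectors. -/
def cross (u v : Fin 2 → ℤ) : ℤ := u 0 * v 1 - u 1 * v 0

/-- The directions of `u`, `v`, `w` are distinct and follow each other in this cyclic order, turning
counterclockwise (`ε = 1`) or clockwise (`ε = -1`): at least two of the turns from `u` to `v`,
from `v` to `w` and from `w` to `u` lie strictly between `0` and `π`. -/
def CyclicallyOrdered (ε : ℤˣ) (u v w : Fin 2 → ℤ) : Prop :=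
  (0 < ε * cross u v ∧ 0 < ε * cross v w) ∨
  (0 < ε * cross v w ∧ 0 < ε * cross w u) ∨
  (0 < ε * cross w u ∧ 0 < ε * cross u v)

/-- The zig-zag paths through a node occur around it, with respect to the rotation `σ`, in the cyclic
order of the directions of their windings. (The edges `e`, `σ^i e`, `σ^j e` are distinct edges at
the node, in the cyclic order of `σ`; the passages of zig-zag paths between consecutive edges at
the node correspond to the edges at the node that they traverse from white to black.) -/
def OrderedAround (ε : ℤˣ) (σ : Equiv.Perm E) : Prop :=
  ∀ (e : E) (i j : ℕ), 0 < i → i < j → (∀ m, 0 < m → m ≤ j → (σ ^ m) e ≠ e) →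
    CyclicallyOrdered ε (T.winding e) (T.winding ((σ ^ i) e)) (T.winding ((σ ^ j) e))

/-- Consistency of a brane tiling, in the form of proper ordering: no zig-zag path is homologically
trivial, the two zig-zag passages through an edge have different directions, and around each
node the zig-zag paths occur in the cyclic order of the directions of their windings. The sign
`ε` tells whether the basis `γ_x`, `γ_y` is positively or negatively oriented. -/
structure IsConsistent : Prop where
  winding_ne_zero : ∀ e, T.winding e ≠ 0
  direction_ne : ∀ e, ¬ SameRay ℤ (T.winding e) (T.winding (T.σB e))
  properly_ordered : ∃ ε : ℤˣ, T.OrderedAround ε T.σW ∧ T.OrderedAround ε T.σB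

/-! ### Newton polynomial, `r`- and `s`-matchings, period -/

/-- The height change of the perfect matching `M` with respect to the reference matching `M₀`. This
is the lattice point of `M`, the lattice point of `M₀` being the origin. -/
def height (M₀ M : T.PerfectMatching) : Fin 2 → ℤ := ∑ e ∈ M.1, T.crossing e - ∑ e ∈ M₀.1, T.crossing e

/-- The Newton polygon, with the lattice point of `M₀` as origin. -/
def newtonPolygon (M₀ : T.PerfectMatching) : Set (Fin 2 → ℝ) :=
  convexHull ℝ (Set.range fun M : T.PerfectMatching => fun j => (T.height M₀ M j : ℝ))

/-- The `r`-matchings, those that do not contribute to the constant term. -/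
def RMatching (M₀ : T.PerfectMatching) : Type _ := {M : T.PerfectMatching // T.height M₀ M ≠ 0}

/-- The `s`-matchings, those that contribute to the constant term. -/
def SMatching (M₀ : T.PerfectMatching) : Type _ := {M : T.PerfectMatching // T.height M₀ M = 0}

instance (M₀ : T.PerfectMatching) : Finite (T.RMatching M₀) := inferInstanceAs (Finite (Subtype _))

instance (M₀ : T.PerfectMatching) : Finite (T.SMatching M₀) := inferInstanceAs (Finite (Subtype _))

instance (M₀ : T.PerfectMatching) : Fintype (T.RMatching M₀) := Fintype.ofFinite _

instance (M₀ : T.PerfectMatching) : Fintype (T.SMatching M₀) := Fintype.ofFinite _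

/-- `p(z, w) = ∑ᵢ rᵢ z^{mᵢ} w^{nᵢ}` with general coefficients `rᵢ`, where `x 0 = z`, `x 1 = w`. -/
def newton (M₀ : T.PerfectMatching) (r : T.RMatching M₀ → ℂ) (x : Fin 2 → ℂ) : ℂ :=
  ∑ i, r i * (x 0 ^ T.height M₀ i.1 0 * x 1 ^ T.height M₀ i.1 1)

/-- The period `u₀(k) = (2πi)⁻² ∫_{|z|=|w|=1} (1 - k⁻¹ p(z, w))⁻¹ dz/z dw/w`. -/
def period (M₀ : T.PerfectMatching) (r : T.RMatching M₀ → ℂ) (k : ℂ) : ℂ :=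
  1 / (2 * π * Complex.I) ^ 2 *
    torusIntegral (fun x => 1 / (1 - k⁻¹ * T.newton M₀ r x) * (1 / x 0) * (1 / x 1)) 0 1

/-- The `2 × N` matrix whose columns are the lattice points of the `r`-matchings. -/
def latticeMatrix (M₀ : T.PerfectMatching) : Matrix (Fin 2) (T.RMatching M₀) ℤ :=
  Matrix.of fun j i => T.height M₀ i.1 j

open Classical in
/-- The coefficient `f_n`, as a polynomial in the weights of the `r`-matchings. -/
def coeff (M₀ : T.PerfectMatching) (n : ℕ) : MvPolynomial (T.RMatching M₀) ℤ :=
  ∑ l ∈ (Finset.univ : Finset (T.RMatching M₀)).finsuppAntidiag n with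
      T.latticeMatrix M₀ *ᵥ (fun i => (l i : ℤ)) = 0,
    MvPolynomial.monomial l ((n.factorial / ∏ i, (l i).factorial : ℕ) : ℤ)

/-! ### F-term charges -/

open Classical in
/-- The perfect matching matrix. -/
def matchingMatrix : Matrix E T.PerfectMatching ℤ :=
  Matrix.of fun e M => if e ∈ M.1 then 1 else 0

/-- The integral kernel of the perfect matching matrix; the rows of the F-term charge matrix `Q_F`
are a basis of it. -/
def fTermCharges : Submodule ℤ (T.PerfectMatching → ℤ) := LinearMap.ker T.matchingMatrix.mulVecLin

open Classical in
/-- `l₁ r₁ + … + l_N r_N = l'₁ s₁ + l'₂ s₂ + …` as multisets of edges. -/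
def Regroups (M₀ : T.PerfectMatching) (l : T.RMatching M₀ →₀ ℕ) (l' : T.SMatching M₀ → ℕ) : Prop :=
  ∀ e, ∑ i with e ∈ i.1.1, l i = ∑ j with e ∈ j.1.1, l' j

/-- The relations `∑ l_i r_i = ∑ l'_j s_j` read off from the monomials `r^l` which occur in the
coefficients of the period. -/
def periodRelations (M₀ : T.PerfectMatching) : Set (T.PerfectMatching → ℤ) :=
  {c | ∃ (n : ℕ) (l : T.RMatching M₀ →₀ ℕ) (l' : T.SMatching M₀ → ℕ),
    l ∈ (T.coeff M₀ n).support ∧ T.Regroups M₀ l l' ∧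
      (∀ i : T.RMatching M₀, c i.1 = l i) ∧ (∀ j : T.SMatching M₀, c j.1 = -(l' j : ℤ))}

/-! ### The master space -/

open Classical in
/-- The (abelian) superpotential: one term for each node, with sign `+` for the white and `-` for
the black nodes. -/
def superpotential : MvPolynomial E ℂ :=
  ∑ v, ∏ e with T.white e = v, MvPolynomial.X e - ∑ v, ∏ e with T.black e = v, MvPolynomial.X e

/-- The ideal of F-term relations. The master space is the spectrum of the quotient by it. -/
def fTermIdeal : Ideal (MvPolynomial E ℂ) :=
  Ideal.span (Set.range fun e => MvPolynomial.pderiv e T.superpotential)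

/-- The ideal of the coherent component: the part of the master space that is the closure of the locus
where all `X_I` are nonzero, i.e. the saturation of the F-term ideal by the product of the `X_I`. -/
def coherentIdeal : Ideal (MvPolynomial E ℂ) where
  carrier := {f | ∃ n : ℕ, (∏ e, MvPolynomial.X e) ^ n * f ∈ T.fTermIdeal}
  zero_mem' := ⟨0, by simp⟩
  add_mem' := by
    rintro a b ⟨m, hm⟩ ⟨n, hn⟩
    refine ⟨m + n, ?_⟩
    have h1 := T.fTermIdeal.mul_mem_left ((∏ e, MvPolynomial.X e) ^ n) hm
    have h2 := T.fTermIdeal.mul_mem_left ((∏ e, MvPolynomial.X e) ^ m) hn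
    convert T.fTermIdeal.add_mem h1 h2 using 1
    ring
  smul_mem' := by
    rintro c a ⟨n, hn⟩
    refine ⟨n, ?_⟩
    have h := T.fTermIdeal.mul_mem_left c hn
    convert h using 1
    simp only [smul_eq_mul]
    ring

open Classical in
/-- Each field `X_I` is the product of the GLSM fields `q_M` of the matchings that contain `e_I`. -/
def toGLSM : MvPolynomial E ℂ →ₐ[ℂ] MvPolynomial T.PerfectMatching ℂ :=
  MvPolynomial.aeval fun e => ∏ M with e ∈ M.1, MvPolynomial.X M

/-- The coordinate ring of the symplectic quotient `ℂ[q] // Q`: the polynomials in the GLSM fields all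
of whose monomials are neutral under each of the charge vectors in `Q`. -/
def invariants (Q : Set (T.PerfectMatching → ℤ)) :
    Subalgebra ℂ (MvPolynomial T.PerfectMatching ℂ) where
  carrier := {f | ∀ a ∈ f.support, ∀ c ∈ Q, ∑ M, c M * (a M : ℤ) = 0}
  mul_mem' := by
    classical
    intro f g hf hg a ha c hc
    obtain ⟨b, hb, b', hb', rfl⟩ := Finset.mem_add.1 (MvPolynomial.support_mul f g ha)
    simp [mul_add, Finset.sum_add_distrib, hf b hb c hc, hg b' hb' c hc]
  add_mem' := by
    classical
    intro f g hf hg a ha c hc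
    rcases Finset.mem_union.1 (MvPolynomial.support_add ha) with h | h
    · exact hf a h c hc
    · exact hg a h c hc
  algebraMap_mem' := by
    classical
    intro z a ha c hc
    have h0 : a = 0 := by
      by_contra hne
      simp [MvPolynomial.algebraMap_eq, MvPolynomial.coeff_C, Ne.symm hne] at ha
    simp [h0]

end BraneTiling

end

/-! Period. On the unit torus, integrating `p ^ n` against dz/z dw/w picks out its constant term,
which is `f_n` by the multinomial theorem. By compactness |p/k| is bounded by some q < 1, so the
geometric series may be integrated termwise.

Regrouping. A monomial of `f_n` is a multiset of n matchings of total height zero. Subtracting n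
copies of `M₀` leaves a null-homologous 1-cycle, the boundary of an integral face function h. By
Hermite's identity h is the sum of the layers ⌊(h + j)/n⌋, 0 ≤ j < n, and `M₀` plus the boundary of
a layer is again a 0-1 function with node sums one, i.e. an `s`-matching
(`exists_eq_sum_ind_smatching`).

Generation. A charge that is nonnegative on `r`- and nonpositive on `s`-matchings is itself a period
relation. Given one charge y with all these signs strict (`exists_relation`), any charge c is the
difference of the period relations c + Ny and Ny for large N. Interiority of the origin gives
positive integers that combine the heights to zero; to subtract every `s`-matching once and remain
nonnegative on the edges, each edge must lie in an `r`-matching. This uses consistency: choosing at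
each node the edge where the angle of the zig-zag directions drops gives a perfect matching that
maximizes the number of passages of a given zig-zag path through its edges. If its height were zero,
that number would be the same for all matchings, hence come from a node potential, and the path
would be null-homologous.

Master space. By matching duality, edge weights with equal totals on all matchings are node
potentials. On the coherent component all node products equal one non-zero-divisor, so monomials of
equal GLSM degree coincide there (`prod_coord_eq`); this gives the kernel. For the image, an
exponent vector killed by all charges extends to integral edge weights, because the matchings
generate a direct summand of the lattice of edge functions; an optimal dual potential then makes the
weights nonnegative. -/

noncomputable section

/-! ### Node sums, Hall's theorem and matching duality -/

namespace BipartiteMap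

variable {E : Type*} [Fintype E] {G : BipartiteMap E}

open Classical in
/-- All node sums of `x` are equal to `k`. -/
def IsRegular (G : BipartiteMap E) (x : E → ℤ) (k : ℤ) : Prop :=
  (∀ v, ∑ e with G.white e = v, x e = k) ∧ (∀ v, ∑ e with G.black e = v, x e = k)

open Classical in
/-- The indicator function of a perfect matching. -/
def PerfectMatching.ind (M : G.PerfectMatching) (e : E) : ℤ := if e ∈ M.1 then 1 else 0

theorem isOneCycle_iff {x : E → ℤ} : G.IsOneCycle x ↔ G.IsRegular x 0 := Iff.rfl

namespace IsRegular

variable {x y : E → ℤ} {k m : ℤ}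

theorem add (hx : G.IsRegular x k) (hy : G.IsRegular y m) : G.IsRegular (x + y) (k + m) :=
  ⟨fun v => by simp [Finset.sum_add_distrib, hx.1 v, hy.1 v],
    fun v => by simp [Finset.sum_add_distrib, hx.2 v, hy.2 v]⟩

theorem smul (c : ℤ) (hx : G.IsRegular x k) : G.IsRegular (c • x) (c * k) :=
  ⟨fun v => by simp [← Finset.mul_sum, hx.1 v], fun v => by simp [← Finset.mul_sum, hx.2 v]⟩

theorem sub (hx : G.IsRegular x k) (hy : G.IsRegular y m) : G.IsRegular (x - y) (k - m) :=
  ⟨fun v => by simp [hx.1 v, hy.1 v], fun v => by simp [hx.2 v, hy.2 v]⟩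

theorem sum {ι : Type*} (s : Finset ι) {x : ι → E → ℤ} {k : ι → ℤ}
    (h : ∀ i ∈ s, G.IsRegular (x i) (k i)) : G.IsRegular (∑ i ∈ s, x i) (∑ i ∈ s, k i) := by
  constructor <;> intro v <;> simp only [Finset.sum_apply] <;> rw [Finset.sum_comm]
  · exact Finset.sum_congr rfl fun i hi => (h i hi).1 v
  · exact Finset.sum_congr rfl fun i hi => (h i hi).2 v

theorem sum_mul_white (hx : G.IsRegular x k) (a : G.White → ℤ) :
    ∑ e, x e * a (G.white e) = k * ∑ v, a v := by
  classical
  rw [← Finset.sum_fiberwise Finset.univ G.white, Finset.mul_sum]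
  refine Finset.sum_congr rfl fun v _ => ?_
  have : ∀ e ∈ Finset.univ.filter (fun e => G.white e = v),
      x e * a (G.white e) = x e * a v := fun e he => by rw [(Finset.mem_filter.1 he).2]
  rw [Finset.sum_congr rfl this, ← Finset.sum_mul]
  congr 1
  convert hx.1 v

theorem sum_mul_black (hx : G.IsRegular x k) (a : G.Black → ℤ) :
    ∑ e, x e * a (G.black e) = k * ∑ v, a v := by
  classical
  rw [← Finset.sum_fiberwise Finset.univ G.black, Finset.mul_sum]
  refine Finset.sum_congr rfl fun v _ => ?_
  have : ∀ e ∈ Finset.univ.filter (fun e => G.black e = v),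
      x e * a (G.black e) = x e * a v := fun e he => by rw [(Finset.mem_filter.1 he).2]
  rw [Finset.sum_congr rfl this, ← Finset.sum_mul]
  congr 1
  convert hx.2 v

end IsRegular

open Classical in
theorem sum_ind_filter (M : G.PerfectMatching) (p : E → Prop) (h : ∃! e, e ∈ M.1 ∧ p e) :
    ∑ e with p e, M.ind e = 1 := by
  obtain ⟨e, ⟨he, hp⟩, hu⟩ := h
  rw [Finset.sum_eq_single e]
  · simp [PerfectMatching.ind, he]
  · intro f hf hne
    have : f ∉ M.1 := fun hM => hne (hu f ⟨hM, (Finset.mem_filter.1 hf).2⟩)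
    simp [PerfectMatching.ind, this]
  · intro h; simp [hp] at h

theorem PerfectMatching.isRegular_ind (M : G.PerfectMatching) : G.IsRegular M.ind 1 :=
  ⟨fun v => sum_ind_filter M _ (M.2.1 v), fun v => sum_ind_filter M _ (M.2.2 v)⟩

theorem PerfectMatching.ind_nonneg (M : G.PerfectMatching) (e : E) : 0 ≤ M.ind e := by
  unfold PerfectMatching.ind; split_ifs <;> norm_num

theorem sum_ind_mul (M : G.PerfectMatching) (u : E → ℤ) :
    ∑ e, M.ind e * u e = ∑ e ∈ M.1, u e := by
  classical
  simp [PerfectMatching.ind, Finset.sum_ite_mem]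

open Classical in
theorem existsUnique_of_sum_eq_one {x : E → ℤ} (hx : ∀ e, x e = 0 ∨ x e = 1) (p : E → Prop)
    (h : ∑ e with p e, x e = 1) :
    ∃! e, e ∈ Finset.univ.filter (fun e => x e = 1) ∧ p e := by
  have hsum : ∑ e with p e, x e = ((Finset.univ.filter (fun e => x e = 1 ∧ p e)).card : ℤ) := by
    rw [Finset.card_filter, Nat.cast_sum, Finset.sum_filter]
    refine Finset.sum_congr rfl fun e _ => ?_
    rcases hx e with h | h <;> simp [h]
  rw [hsum] at h
  obtain ⟨e, he⟩ := Finset.card_eq_one.1 (by exact_mod_cast h)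
  have hmem : ∀ f, (x f = 1 ∧ p f) ↔ f = e := fun f => by
    simpa using congrArg (f ∈ ·) he
  exact ⟨e, by simpa using (hmem e).2 rfl, fun f hf => (hmem f).1 (by simpa using hf)⟩

/-- A `0`-`1`-valued function with node sums `1` is the indicator of a perfect matching. -/
theorem IsRegular.exists_ind_eq {x : E → ℤ} (hx : ∀ e, x e = 0 ∨ x e = 1)
    (h : G.IsRegular x 1) : ∃ M : G.PerfectMatching, M.ind = x := by
  classical
  refine ⟨⟨Finset.univ.filter (fun e => x e = 1), fun v => ?_, fun v => ?_⟩, ?_⟩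
  · convert existsUnique_of_sum_eq_one hx _ (h.1 v)
  · convert existsUnique_of_sum_eq_one hx _ (h.2 v)
  · ext e
    rcases hx e with h | h <;> simp [PerfectMatching.ind, h]

theorem card_white_eq_card_black (M : G.PerfectMatching) :
    Fintype.card G.White = Fintype.card G.Black := by
  have h1 := M.isRegular_ind.sum_mul_white (fun _ => 1)
  have h2 := M.isRegular_ind.sum_mul_black (fun _ => 1)
  rw [h1] at h2
  simpa using h2

-- Hall's theorem gives an injection from white to black nodes, bijective by cardinality. Since the
-- graph may have multiple edges, an edge of `A` is then chosen for each matched pair.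
open Classical in
theorem exists_matching_subset (A : Finset E)
    (hcard : Fintype.card G.White = Fintype.card G.Black)
    (hall : ∀ S : Finset G.White,
      S.card ≤ ((A.filter (fun e => G.white e ∈ S)).image G.black).card) :
    ∃ M : G.PerfectMatching, M.1 ⊆ A := by
  have hh := (Finset.all_card_le_biUnion_card_iff_exists_injective
    (fun w => (A.filter (fun e => G.white e = w)).image G.black)).1 (by
      intro S
      convert hall S using 2
      ext b
      simp only [Finset.mem_biUnion, Finset.mem_image, Finset.mem_filter]
      constructor
      · rintro ⟨w, hw, e, ⟨he, rfl⟩, rfl⟩; exact ⟨e, ⟨he, hw⟩, rfl⟩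
      · rintro ⟨e, ⟨he, hw⟩, rfl⟩; exact ⟨_, hw, e, ⟨he, rfl⟩, rfl⟩)
  obtain ⟨f, hf, hft⟩ := hh
  have hbij : Function.Bijective f := (Fintype.bijective_iff_injective_and_card f).2 ⟨hf, hcard⟩
  have : ∀ w, ∃ e ∈ A, G.white e = w ∧ G.black e = f w := by
    intro w
    obtain ⟨e, he, heq⟩ := Finset.mem_image.1 (hft w)
    exact ⟨e, (Finset.mem_filter.1 he).1, (Finset.mem_filter.1 he).2, heq⟩
  choose g hgA hgw hgb using this
  refine ⟨⟨Finset.univ.image g, fun v => ⟨g v, ⟨by simp, hgw v⟩, ?_⟩, fun v => ?_⟩, ?_⟩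
  · rintro e ⟨he, rfl⟩
    obtain ⟨w, -, rfl⟩ := Finset.mem_image.1 he
    rw [hgw]
  · obtain ⟨w, rfl⟩ := hbij.2 v
    refine ⟨g w, ⟨by simp, hgb w⟩, ?_⟩
    rintro e ⟨he, h⟩
    obtain ⟨w', -, rfl⟩ := Finset.mem_image.1 he
    rw [hgb] at h
    rw [hf h]
  · intro e he
    obtain ⟨w, -, rfl⟩ := Finset.mem_image.1 he
    exact hgA w

/-- Every nonnegative integral function with constant node sums is a sum of perfect matchings. -/
theorem IsRegular.exists_eq_sum_ind (M₀ : G.PerfectMatching) (k : ℕ) {x : E → ℤ}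
    (hx : G.IsRegular x k) (h0 : ∀ e, 0 ≤ x e) :
    ∃ c : G.PerfectMatching → ℤ, x = ∑ M, c M • M.ind := by
  classical
  induction k generalizing x with
  | zero =>
    refine ⟨0, ?_⟩
    ext e
    have := (Finset.sum_eq_zero_iff_of_nonneg (fun f _ => h0 f)).1 (hx.1 (G.white e)) e (by simp)
    simp [this]
  | succ k ih =>
    obtain ⟨M, hM⟩ := exists_matching_subset (G := G) (Finset.univ.filter fun e => 0 < x e)
      (card_white_eq_card_black M₀) (by
        intro S
        set N := ((Finset.univ.filter fun e => 0 < x e).filter (fun e => G.white e ∈ S)).image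
          G.black with hN
        -- Hall's condition by double counting: all the weight leaving `S` arrives in `N`, and every
        -- node carries the same weight k + 1 > 0.
        have h1 := hx.sum_mul_white (fun v => if v ∈ S then 1 else 0)
        have h2 := hx.sum_mul_black (fun v => if v ∈ N then 1 else 0)
        have h3 : ∑ e, x e * (if G.white e ∈ S then 1 else 0) ≤
            ∑ e, x e * (if G.black e ∈ N then 1 else 0) := by
          refine Finset.sum_le_sum fun e _ => ?_
          by_cases hw : G.white e ∈ S
          · rcases (h0 e).lt_or_eq with hp | hp
            · have : G.black e ∈ N := by
                rw [hN]; exact Finset.mem_image_of_mem _ (by simp [hp, hw])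
              simp [hw, this]
            · simp [← hp]
          · have := h0 e
            rw [if_neg hw, mul_zero]
            split_ifs <;> simp [this]
        rw [h1, h2] at h3
        have h4 := le_of_mul_le_mul_left h3 (by positivity)
        simpa using h4)
    obtain ⟨c, hc⟩ := ih (x := x - M.ind) (by
        convert hx.sub M.isRegular_ind using 1
        push_cast; ring) (by
        intro e
        by_cases he : e ∈ M.1
        · have := (Finset.mem_filter.1 (hM he)).2
          simp only [Pi.sub_apply, PerfectMatching.ind, he, if_true]
          omega
        · simpa [PerfectMatching.ind, he] using h0 e)
    refine ⟨c + Pi.single M 1, ?_⟩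
    simp only [Pi.add_apply, add_smul, Finset.sum_add_distrib]
    rw [← hc, Finset.sum_eq_single M]
    · simp
    · intro b _ hb; simp [hb]
    · simp

/-- Weighted matching duality: there is an integral node potential below the weights `u` whose
total is the weight of a perfect matching. -/
theorem exists_potential (M₀ : G.PerfectMatching) (u : E → ℤ) :
    ∃ (a : G.White → ℤ) (b : G.Black → ℤ) (M : G.PerfectMatching),
      (∀ e, a (G.white e) + b (G.black e) ≤ u e) ∧ ∑ e ∈ M.1, u e = ∑ v, a v + ∑ v, b v := by
  classical
  have key : ∀ (M : G.PerfectMatching) (a : G.White → ℤ) (b : G.Black → ℤ),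
      ∑ e, M.ind e * (a (G.white e) + b (G.black e)) = ∑ v, a v + ∑ v, b v := by
    intro M a b
    simp only [mul_add, Finset.sum_add_distrib, M.isRegular_ind.sum_mul_white,
      M.isRegular_ind.sum_mul_black, one_mul]
  -- The dual maximum exists because the totals are integers bounded by the weight of `M₀`.
  obtain ⟨m, ⟨a, b, hab, hm⟩, hmax⟩ := Int.exists_greatest_of_bdd
    (P := fun m => ∃ (a : G.White → ℤ) (b : G.Black → ℤ),
      (∀ e, a (G.white e) + b (G.black e) ≤ u e) ∧ ∑ v, a v + ∑ v, b v = m)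
    ⟨∑ e ∈ M₀.1, u e, by
      rintro _ ⟨a, b, hab, rfl⟩
      rw [← key M₀, ← sum_ind_mul]
      exact Finset.sum_le_sum fun e _ => mul_le_mul_of_nonneg_left (hab e) (M₀.ind_nonneg e)⟩
    ⟨_, fun _ => -∑ e, |u e|, 0, fun e => by
      have := Finset.single_le_sum (f := fun e => |u e|) (fun e _ => abs_nonneg _)
        (Finset.mem_univ e)
      have h2 := neg_abs_le (u e)
      simp only [Pi.zero_apply] at *
      linarith, rfl⟩
  obtain ⟨M, hM⟩ := exists_matching_subset (G := G)
    (Finset.univ.filter fun e => a (G.white e) + b (G.black e) = u e)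
    (card_white_eq_card_black M₀) (by
      intro S
      set N := ((Finset.univ.filter fun e => a (G.white e) + b (G.black e) = u e).filter
        (fun e => G.white e ∈ S)).image G.black with hN
      by_contra! hlt
      -- If Hall's condition fails for the tight edges, raising `a` by one on `S` and lowering `b`
      -- by one on `N` increases the total by |S| - |N| > 0. It stays admissible: a tight edge from
      -- `S` ends in `N`, and a non-tight edge has integral slack at least one.
      have := hmax _ ⟨fun v => a v + if v ∈ S then 1 else 0,
        fun v => b v - if v ∈ N then 1 else 0, fun e => ?_, rfl⟩
      · simp only [Finset.sum_add_distrib, Finset.sum_sub_distrib] at this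
        simp at this
        omega
      · have h1 := hab e
        by_cases hw : G.white e ∈ S
        · by_cases ht : a (G.white e) + b (G.black e) = u e
          · have : G.black e ∈ N := by
              rw [hN]; exact Finset.mem_image_of_mem _ (by simp [ht, hw])
            simp only [hw, this, if_true]
            omega
          · simp only [hw, if_true]
            split_ifs <;> omega
        · simp only [hw, if_false]
          split_ifs <;> omega)
  refine ⟨a, b, M, hab, ?_⟩
  rw [← key M, sum_ind_mul]
  exact Finset.sum_congr rfl fun e he => (Finset.mem_filter.1 (hM he)).2.symm

end BipartiteMap

/-! ### Boundaries of face functions and decomposition into `s`-matchings -/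

namespace BipartiteMap

variable {E : Type*} {G : BipartiteMap E}

theorem white_σW (e : E) : G.white (G.σW e) = G.white e :=
  Quotient.sound (s := Equiv.Perm.SameCycle.setoid G.σW)
    (Equiv.Perm.SameCycle.symm ⟨1, by simp⟩)

theorem black_σB (e : E) : G.black (G.σB e) = G.black e :=
  Quotient.sound (s := Equiv.Perm.SameCycle.setoid G.σB)
    (Equiv.Perm.SameCycle.symm ⟨1, by simp⟩)

theorem black_σB_symm (e : E) : G.black (G.σB.symm e) = G.black e := by
  conv_rhs => rw [← G.σB.apply_symm_apply e, black_σB]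

theorem IsFaceFunction.faceBoundary_eq {h : E → ℤ} (hh : G.IsFaceFunction h) (e : E) :
    G.faceBoundary h e = h e - h (G.σW e) := by
  have := hh (G.σB.symm e)
  rw [Equiv.apply_symm_apply] at this
  rw [faceBoundary, this]

theorem IsFaceFunction.isRegular_faceBoundary [Fintype E] {h : E → ℤ} (hh : G.IsFaceFunction h) :
    G.IsRegular (G.faceBoundary h) 0 := by
  classical
  constructor <;> intro v
  · simp only [hh.faceBoundary_eq, Finset.sum_sub_distrib, Finset.sum_filter]
    rw [sub_eq_zero, ← Equiv.sum_comp G.σW]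
    simp only [white_σW]
  · simp only [faceBoundary, Finset.sum_sub_distrib, Finset.sum_filter]
    rw [sub_eq_zero, ← Equiv.sum_comp G.σB.symm]
    simp only [black_σB_symm]

end BipartiteMap

/-- Hermite's identity: replacing h by h + 1 drops the summand h / n and adds (h + n) / n = h / n +
1, so both sides grow by one; at h = 0 all summands vanish. -/
theorem Int.sum_range_add_ediv (n : ℕ) (hn : 0 < n) (h : ℤ) :
    ∑ j ∈ Finset.range n, (h + j) / n = h := by
  have hn' : (n : ℤ) ≠ 0 := by exact_mod_cast hn.ne'
  have step : ∀ h : ℤ, ∑ j ∈ Finset.range n, (h + 1 + j) / n =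
      ∑ j ∈ Finset.range n, (h + j) / (n : ℤ) + 1 := by
    intro h
    have h1 := Finset.sum_range_succ (fun j : ℕ => (h + j) / (n : ℤ)) n
    rw [Finset.sum_range_succ'] at h1
    have h2 : (h + (n : ℕ)) / (n : ℤ) = h / n + 1 := by
      rw [Int.add_ediv_of_dvd_right (dvd_refl _), Int.ediv_self hn']
    rw [h2] at h1
    have h3 : ∀ j : ℕ, (h + ((j + 1 : ℕ) : ℤ)) = h + 1 + j := fun j => by push_cast; ring
    simp only [h3, Nat.cast_zero, add_zero] at h1
    linarith
  induction h using Int.induction_on with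
  | zero =>
    refine Finset.sum_eq_zero fun j hj => ?_
    rw [zero_add]
    exact Int.ediv_eq_zero_of_lt (by positivity) (by exact_mod_cast Finset.mem_range.1 hj)
  | succ i ih => rw [step, ih]
  | pred i ih =>
    have := step (-i - 1)
    rw [sub_add_cancel, ih] at this
    linarith

namespace BraneTiling

variable {E : Type*} [Fintype E] (T : BraneTiling E)

/-- The class of a function on the edges, as a pairing with the crossing numbers. -/
def pairing (x : E → ℤ) : Fin 2 → ℤ := ∑ e, x e • T.crossing e

theorem pairing_add (x y : E → ℤ) : T.pairing (x + y) = T.pairing x + T.pairing y := by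
  simp [pairing, add_smul, Finset.sum_add_distrib]

theorem pairing_smul (c : ℤ) (x : E → ℤ) : T.pairing (c • x) = c • T.pairing x := by
  simp [pairing, mul_smul, Finset.smul_sum]

theorem pairing_sub (x y : E → ℤ) : T.pairing (x - y) = T.pairing x - T.pairing y := by
  simp [pairing, sub_smul, Finset.sum_sub_distrib]

theorem pairing_sum {ι : Type*} (s : Finset ι) (x : ι → E → ℤ) :
    T.pairing (∑ i ∈ s, x i) = ∑ i ∈ s, T.pairing (x i) := by
  simp only [pairing, Finset.sum_apply, Finset.sum_smul]
  rw [Finset.sum_comm]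

theorem pairing_ind (M : T.PerfectMatching) : T.pairing M.ind = ∑ e ∈ M.1, T.crossing e := by
  classical
  simp [pairing, BipartiteMap.PerfectMatching.ind, Finset.sum_ite_mem, ite_smul]

theorem height_eq (M₀ M : T.PerfectMatching) :
    T.height M₀ M = T.pairing M.ind - T.pairing M₀.ind := by
  rw [pairing_ind, pairing_ind, height]

variable {T}

/-- Nonnegative functions of height zero with constant node sums are sums of `s`-matchings. -/
theorem exists_eq_sum_ind_smatching (M₀ : T.PerfectMatching) (n : ℕ) {x : E → ℤ}
    (hx : T.IsRegular x n) (h0 : ∀ e, 0 ≤ x e) (hp : T.pairing x = (n : ℤ) • T.pairing M₀.ind) :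
    ∃ l : T.SMatching M₀ → ℕ, ∑ j, l j = n ∧ ∀ e, x e = ∑ j, (l j : ℤ) * j.1.ind e := by
  classical
  rcases n.eq_zero_or_pos with rfl | hn
  · refine ⟨0, by simp, fun e => ?_⟩
    have := (Finset.sum_eq_zero_iff_of_nonneg (fun f _ => h0 f)).1 (hx.1 (T.white e)) e (by simp)
    simp [this]
  have hle : ∀ e, x e ≤ n := fun e => by
    rw [← hx.1 (T.white e)]
    exact Finset.single_le_sum (f := x) (fun f _ => h0 f) (by simp)
  have hcyc : T.IsOneCycle (x - (n : ℤ) • M₀.ind) := by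
    rw [BipartiteMap.isOneCycle_iff]
    convert hx.sub (M₀.isRegular_ind.smul n) using 1
    ring
  obtain ⟨h, hh, hxh⟩ := T.exists_boundary _ hcyc (by
    have : T.pairing (x - (n : ℤ) • M₀.ind) = 0 := by
      rw [pairing_sub, pairing_smul, hp, sub_self]
    exact this)
  have hn' : (0 : ℤ) < n := by exact_mod_cast hn
  have hface : ∀ j : ℕ, T.IsFaceFunction fun e => (h e + j) / (n : ℤ) := fun j e => by
    simp only [hh e]
  -- Since 0 ≤ x ≤ n, the jump of `h` across an edge lies in [-n, 0] on `M₀` and in [0, n] off it.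
  -- The jump of each layer is therefore in {-1, 0}, respectively {0, 1}, and adding it to `M₀`
  -- leaves a 0-1 function.
  have hs : ∀ j : ℕ, ∃ s : T.SMatching M₀,
      s.1.ind = M₀.ind + T.faceBoundary fun e => (h e + j) / (n : ℤ) := by
    intro j
    have hreg := M₀.isRegular_ind.add (hface j).isRegular_faceBoundary
    rw [add_zero] at hreg
    obtain ⟨M, hM⟩ := hreg.exists_ind_eq (fun e => by
      have h1 := congrFun hxh e
      have h2 := h0 e
      have h3 := hle e
      simp only [Pi.sub_apply, Pi.smul_apply, smul_eq_mul, BipartiteMap.faceBoundary] at h1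
      simp only [Pi.add_apply, BipartiteMap.faceBoundary]
      set p := h e
      set q := h (T.σB.symm e)
      have hadd : ∀ r : ℤ, (r + n + j) / (n : ℤ) = (r + j) / n + 1 := fun r => by
        rw [show r + n + j = r + j + n by ring, Int.add_ediv_of_dvd_right (dvd_refl _),
          Int.ediv_self hn'.ne']
      have hmono : ∀ r t : ℤ, r ≤ t → (r + j) / (n : ℤ) ≤ (t + j) / n := fun r t hrt =>
        Int.ediv_le_ediv hn' (by linarith)
      by_cases he : e ∈ M₀.1
      · simp only [BipartiteMap.PerfectMatching.ind, he, if_true] at h1 ⊢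
        have h4 := hmono p q (by linarith)
        have h5 := hmono q (p + n) (by linarith)
        rw [hadd] at h5
        omega
      · simp only [BipartiteMap.PerfectMatching.ind, he, if_false] at h1 ⊢
        have h4 := hmono q p (by linarith)
        have h5 := hmono p (q + n) (by linarith)
        rw [hadd] at h5
        omega)
    refine ⟨⟨M, ?_⟩, hM⟩
    rw [height_eq, hM, pairing_add, add_sub_cancel_left]
    exact T.boundary_eq_zero _ (hface j)
  choose s hs using hs
  refine ⟨fun t => ((Finset.range n).filter (fun j => s j = t)).card, ?_, fun e => ?_⟩
  · exact (Finset.card_eq_sum_card_fiberwise (f := s) (t := Finset.univ)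
      (fun _ _ => Finset.mem_coe.2 (Finset.mem_univ _))).symm.trans (Finset.card_range n)
  · have h1 : ∑ j ∈ Finset.range n, (s j).1.ind e = x e := by
      have h2 := congrFun hxh e
      simp only [Pi.sub_apply, Pi.smul_apply, smul_eq_mul, BipartiteMap.faceBoundary] at h2
      simp only [hs, Pi.add_apply, BipartiteMap.faceBoundary, Finset.sum_add_distrib,
        Finset.sum_sub_distrib, Int.sum_range_add_ediv n hn]
      simp
      linarith
    rw [← h1, ← Finset.sum_fiberwise (Finset.range n) s]
    refine Finset.sum_congr rfl fun t _ => ?_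
    rw [Finset.sum_congr rfl (g := fun _ => t.1.ind e)
      (fun j hj => by rw [(Finset.mem_filter.1 hj).2])]
    simp

/-- The monomials of `f_n` are the combinations of `n` lattice points with sum zero. -/
theorem coeff_support_iff (M₀ : T.PerfectMatching) (n : ℕ) (l : T.RMatching M₀ →₀ ℕ) :
    l ∈ (T.coeff M₀ n).support ↔
      ∑ i, l i = n ∧ ∑ i : T.RMatching M₀, (l i : ℤ) • T.height M₀ i.1 = 0 := by
  classical
  rw [MvPolynomial.mem_support_iff, coeff, MvPolynomial.coeff_sum]
  simp only [MvPolynomial.coeff_monomial]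
  rw [Finset.sum_ite_eq']
  have hM : T.latticeMatrix M₀ *ᵥ (fun i => (l i : ℤ)) =
      ∑ i : T.RMatching M₀, (l i : ℤ) • T.height M₀ i.1 := by
    ext j
    simp [Matrix.mulVec, dotProduct, latticeMatrix, mul_comm]
  simp only [Finset.mem_filter, Finset.mem_finsuppAntidiag, hM]
  constructor
  · intro h
    by_contra hc
    refine h (if_neg fun hl => hc ⟨hl.1.1, hl.2⟩)
  · rintro ⟨h1, h2⟩
    rw [if_pos ⟨⟨h1, Finset.subset_univ _⟩, h2⟩]
    -- Multinomial coefficients are positive, so no admissible exponent is lost from the support.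
    have := Nat.multinomial_pos (s := (Finset.univ : Finset (T.RMatching M₀))) (f := l)
    rw [Nat.multinomial, h1] at this
    exact_mod_cast this.ne'

theorem regroups_iff (M₀ : T.PerfectMatching) (l : T.RMatching M₀ →₀ ℕ)
    (l' : T.SMatching M₀ → ℕ) : T.Regroups M₀ l l' ↔
      ∀ e, ∑ i, (l i : ℤ) * i.1.ind e = ∑ j, (l' j : ℤ) * j.1.ind e := by
  classical
  refine forall_congr' fun e => ?_
  rw [← Int.natCast_inj]
  simp [BipartiteMap.PerfectMatching.ind, Finset.sum_filter]

theorem isRegular_sum_ind {ι : Type*} [Fintype ι] (M : ι → T.PerfectMatching) (l : ι → ℤ) :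
    T.IsRegular (fun e => ∑ i, l i * (M i).ind e) (∑ i, l i) := by
  have := BipartiteMap.IsRegular.sum Finset.univ (fun i _ => (M i).isRegular_ind.smul (l i))
  convert this using 1
  · ext e; simp
  · simp

theorem pairing_sum_ind {ι : Type*} [Fintype ι] (M₀ : T.PerfectMatching)
    (M : ι → T.PerfectMatching) (l : ι → ℤ) : T.pairing (fun e => ∑ i, l i * (M i).ind e) =
      ∑ i, l i • T.height M₀ (M i) + (∑ i, l i) • T.pairing M₀.ind := by
  have : (fun e => ∑ i, l i * (M i).ind e) = ∑ i, l i • (M i).ind := by ext e; simp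
  rw [this, pairing_sum, Finset.sum_smul, ← Finset.sum_add_distrib]
  refine Finset.sum_congr rfl fun i _ => ?_
  rw [height_eq, pairing_smul, smul_sub, sub_add_cancel]

theorem exists_regroups (M₀ : T.PerfectMatching) (n : ℕ) (l : T.RMatching M₀ →₀ ℕ)
    (hl : l ∈ (T.coeff M₀ n).support) :
    ∃ l' : T.SMatching M₀ → ℕ, ∑ j, l' j = n ∧ T.Regroups M₀ l l' := by
  rw [coeff_support_iff] at hl
  have hn : ∑ i, (l i : ℤ) = n := by exact_mod_cast hl.1
  obtain ⟨l', h1, h2⟩ := exists_eq_sum_ind_smatching M₀ n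
    (x := fun e => ∑ i, (l i : ℤ) * i.1.ind e)
    (hn ▸ isRegular_sum_ind (fun i : T.RMatching M₀ => i.1) (fun i => (l i : ℤ)))
    (fun e => Finset.sum_nonneg fun i _ => mul_nonneg (by positivity) (i.1.ind_nonneg e))
    (by rw [pairing_sum_ind M₀ (fun i : T.RMatching M₀ => i.1), hl.2, hn, zero_add])
  exact ⟨l', h1, (regroups_iff M₀ l l').2 h2⟩

end BraneTiling

/-! ### Angles of lattice vectors and cyclic order -/

namespace BraneTiling

/-- The angle of a lattice vector, measured counterclockwise for `ε = 1`, clockwise for `ε = -1`. -/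
def angle (ε : ℤˣ) (v : Fin 2 → ℤ) : ℝ := Complex.arg ⟨v 0, ((ε : ℤ) : ℝ) * v 1⟩

/-- The angle of `v`, normalized to lie within a full turn starting at the direction of `θ`. -/
def turn (ε : ℤˣ) (θ v : Fin 2 → ℤ) : ℝ := toIcoMod Real.two_pi_pos (angle ε θ) (angle ε v)

/-- Length of the vector whose angle is `angle ε v`. -/
def len (ε : ℤˣ) (v : Fin 2 → ℤ) : ℝ := ‖(⟨v 0, ((ε : ℤ) : ℝ) * v 1⟩ : ℂ)‖

theorem len_pos (ε : ℤˣ) {v : Fin 2 → ℤ} (hv : v ≠ 0) : 0 < len ε v := by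
  rw [len, norm_pos_iff]
  intro h
  apply hv
  have h0 := congrArg Complex.re h
  have h1 := congrArg Complex.im h
  simp at h0 h1
  ext j
  fin_cases j
  · exact_mod_cast h0
  · exact_mod_cast h1

theorem turn_self (ε : ℤˣ) (θ : Fin 2 → ℤ) : turn ε θ θ = angle ε θ := by
  rw [turn, toIcoMod_apply_left]

theorem le_turn (ε : ℤˣ) (θ v : Fin 2 → ℤ) : angle ε θ ≤ turn ε θ v :=
  left_le_toIcoMod _ _ _

theorem turn_lt (ε : ℤˣ) (θ v : Fin 2 → ℤ) : turn ε θ v < angle ε θ + 2 * π :=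
  toIcoMod_lt_right _ _ _

theorem turn_sub (ε : ℤˣ) (θ u v : Fin 2 → ℤ) : ∃ k : ℤ,
    turn ε θ v - turn ε θ u = (angle ε v - angle ε u) + k * (2 * π) := by
  refine ⟨toIcoDiv Real.two_pi_pos (angle ε θ) (angle ε u) -
    toIcoDiv Real.two_pi_pos (angle ε θ) (angle ε v), ?_⟩
  simp only [turn, toIcoMod, zsmul_eq_mul]
  push_cast
  ring

theorem sin_turn_sub (ε : ℤˣ) (θ u v : Fin 2 → ℤ) :
    len ε u * len ε v * Real.sin (turn ε θ v - turn ε θ u) = ((ε * cross u v : ℤ) : ℝ) := by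
  obtain ⟨k, hk⟩ := turn_sub ε θ u v
  rw [hk, Real.sin_add_int_mul_two_pi, Real.sin_sub]
  have h1 := Complex.norm_mul_cos_arg ⟨u 0, ((ε : ℤ) : ℝ) * u 1⟩
  have h2 := Complex.norm_mul_sin_arg ⟨u 0, ((ε : ℤ) : ℝ) * u 1⟩
  have h3 := Complex.norm_mul_cos_arg ⟨v 0, ((ε : ℤ) : ℝ) * v 1⟩
  have h4 := Complex.norm_mul_sin_arg ⟨v 0, ((ε : ℤ) : ℝ) * v 1⟩
  simp only at h1 h2 h3 h4
  change len ε u * Real.cos (angle ε u) = _ at h1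
  change len ε u * Real.sin (angle ε u) = _ at h2
  change len ε v * Real.cos (angle ε v) = _ at h3
  change len ε v * Real.sin (angle ε v) = _ at h4
  calc _ = (len ε u * Real.cos (angle ε u)) * (len ε v * Real.sin (angle ε v)) -
        (len ε u * Real.sin (angle ε u)) * (len ε v * Real.cos (angle ε v)) := by ring
    _ = _ := by rw [h1, h2, h3, h4, cross]; push_cast; ring

theorem cos_turn_sub (ε : ℤˣ) (θ u v : Fin 2 → ℤ) :
    len ε u * len ε v * Real.cos (turn ε θ v - turn ε θ u) =
      ((u 0 * v 0 + u 1 * v 1 : ℤ) : ℝ) := by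
  obtain ⟨k, hk⟩ := turn_sub ε θ u v
  rw [hk, Real.cos_add_int_mul_two_pi, Real.cos_sub]
  have h1 := Complex.norm_mul_cos_arg ⟨u 0, ((ε : ℤ) : ℝ) * u 1⟩
  have h2 := Complex.norm_mul_sin_arg ⟨u 0, ((ε : ℤ) : ℝ) * u 1⟩
  have h3 := Complex.norm_mul_cos_arg ⟨v 0, ((ε : ℤ) : ℝ) * v 1⟩
  have h4 := Complex.norm_mul_sin_arg ⟨v 0, ((ε : ℤ) : ℝ) * v 1⟩
  simp only at h1 h2 h3 h4
  change len ε u * Real.cos (angle ε u) = _ at h1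
  change len ε u * Real.sin (angle ε u) = _ at h2
  change len ε v * Real.cos (angle ε v) = _ at h3
  change len ε v * Real.sin (angle ε v) = _ at h4
  have hε : ((ε : ℤ) : ℝ) * ((ε : ℤ) : ℝ) = 1 := by
    rcases Int.units_eq_one_or ε with rfl | rfl <;> simp
  calc _ = (len ε u * Real.cos (angle ε u)) * (len ε v * Real.cos (angle ε v)) +
        (len ε u * Real.sin (angle ε u)) * (len ε v * Real.sin (angle ε v)) := by ring
    _ = _ := by
      rw [h1, h2, h3, h4]; push_cast
      linear_combination (u 1 * v 1 : ℝ) * hε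

/-- The sine of the difference is positive, and the difference lies in (-2π, 2π); the second
alternative is the case where the turn passes the reference direction. -/
theorem turn_sub_of_cross_pos {ε : ℤˣ} (θ : Fin 2 → ℤ) {u v : Fin 2 → ℤ}
    (h : 0 < ε * cross u v) :
    (0 < turn ε θ v - turn ε θ u ∧ turn ε θ v - turn ε θ u < π) ∨
      turn ε θ v - turn ε θ u < -π := by
  have h1 := sin_turn_sub ε θ u v
  have h2 : 0 < Real.sin (turn ε θ v - turn ε θ u) := by
    have h3 : (0 : ℝ) < ((ε * cross u v : ℤ) : ℝ) := by exact_mod_cast h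
    rw [← h1] at h3
    by_contra hneg
    exact absurd h3 (not_lt.2 (mul_nonpos_of_nonneg_of_nonpos
      (mul_nonneg (norm_nonneg _) (norm_nonneg _)) (not_lt.1 hneg)))
  have h5 := le_turn ε θ u
  have h6 := turn_lt ε θ v
  set δ := turn ε θ v - turn ε θ u with hδ
  have hδ2 : δ < 2 * π := by linarith
  by_cases ha : δ < -π
  · exact Or.inr ha
  refine Or.inl ⟨?_, ?_⟩
  · by_contra hb
    exact absurd h2 (not_lt.2 (Real.sin_nonpos_of_nonpos_of_neg_pi_le (by linarith) (by linarith)))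
  · by_contra hb
    have := Real.sin_nonneg_of_nonneg_of_le_pi (x := δ - π) (by linarith) (by linarith)
    rw [Real.sin_sub_pi] at this
    linarith

/-- Equal turns have sine 0 and cosine 1 of their difference: the cross product vanishes and the
inner product is positive, which puts the vectors on one ray. -/
theorem turn_ne {ε : ℤˣ} (θ : Fin 2 → ℤ) {u v : Fin 2 → ℤ} (hu : u ≠ 0) (hv : v ≠ 0)
    (h : ¬ SameRay ℤ u v) : turn ε θ u ≠ turn ε θ v := by
  intro heq
  apply h
  have h1 := sin_turn_sub ε θ u v
  have h2 := cos_turn_sub ε θ u v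
  have h3 := cos_turn_sub ε θ v v
  have hl := mul_pos (len_pos ε hu) (len_pos ε hv)
  have hl' := mul_pos (len_pos ε hv) (len_pos ε hv)
  rw [heq, sub_self, Real.sin_zero, mul_zero] at h1
  rw [heq, sub_self, Real.cos_zero, mul_one] at h2
  rw [sub_self, Real.cos_zero, mul_one] at h3
  rw [h2] at hl
  rw [h3] at hl'
  have hc : (ε : ℤ) * cross u v = 0 := by exact_mod_cast h1.symm
  have hc' : u 0 * v 1 - u 1 * v 0 = 0 := (mul_eq_zero.1 hc).resolve_left ε.ne_zero
  have hd : 0 < u 0 * v 0 + u 1 * v 1 := by exact_mod_cast hl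
  have hd' : 0 < v 0 * v 0 + v 1 * v 1 := by exact_mod_cast hl'
  refine Or.inr (Or.inr ⟨_, _, hd', hd, ?_⟩)
  ext j
  fin_cases j
  · simp only [Fin.zero_eta, Pi.smul_apply, smul_eq_mul]
    linear_combination v 1 * hc'
  · simp only [Fin.mk_one, Pi.smul_apply, smul_eq_mul]
    linear_combination (-v 0) * hc'

/-- The real numbers `a`, `b`, `c` are distinct and increasing up to rotation. -/
def CyclicLT (a b c : ℝ) : Prop := (a < b ∧ b < c) ∨ (b < c ∧ c < a) ∨ (c < a ∧ a < b)

/-- Each of two successive turns either increases by less than π or wraps around, dropping by more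
than π. Two wraps would drop by more than the 2π window; the three remaining cases are the three
rotations of an increasing triple. -/
theorem CyclicallyOrdered.cyclicLT {ε : ℤˣ} (θ : Fin 2 → ℤ) {u v w : Fin 2 → ℤ}
    (h : CyclicallyOrdered ε u v w) : CyclicLT (turn ε θ u) (turn ε θ v) (turn ε θ w) := by
  have hu := le_turn ε θ u
  have hv := le_turn ε θ v
  have hw := le_turn ε θ w
  have hu' := turn_lt ε θ u
  have hv' := turn_lt ε θ v
  have hw' := turn_lt ε θ w
  have key : ∀ a b c : ℝ, angle ε θ ≤ c → a < angle ε θ + 2 * π →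
      ((0 < b - a ∧ b - a < π) ∨ b - a < -π) → ((0 < c - b ∧ c - b < π) ∨ c - b < -π) →
      CyclicLT a b c := by
    rintro a b c hc ha (⟨h1, h2⟩ | h1) (⟨h3, h4⟩ | h3)
    · exact Or.inl ⟨by linarith, by linarith⟩
    · exact Or.inr (Or.inr ⟨by linarith, by linarith⟩)
    · exact Or.inr (Or.inl ⟨by linarith, by linarith⟩)
    · linarith
  rcases h with ⟨h1, h2⟩ | ⟨h1, h2⟩ | ⟨h1, h2⟩
  · exact key _ _ _ hw hu' (turn_sub_of_cross_pos θ h1) (turn_sub_of_cross_pos θ h2)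
  · have := key _ _ _ hu hv' (turn_sub_of_cross_pos θ h1) (turn_sub_of_cross_pos θ h2)
    rcases this with h | h | h
    exacts [Or.inr (Or.inl h), Or.inr (Or.inr h), Or.inl h]
  · have := key _ _ _ hv hw' (turn_sub_of_cross_pos θ h1) (turn_sub_of_cross_pos θ h2)
    rcases this with h | h | h
    exacts [Or.inr (Or.inr h), Or.inl h, Or.inr (Or.inl h)]

/-- A function on a cycle that is increasing up to rotation has exactly one descent. -/
theorem existsUnique_descent {E : Type*} [Finite E] (σ : Equiv.Perm E) (g : E → ℝ)
    (hne : ∀ e, g (σ e) ≠ g e)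
    (hcyc : ∀ (e : E) (i j : ℕ), 0 < i → i < j → (∀ m, 0 < m → m ≤ j → (σ ^ m) e ≠ e) →
      CyclicLT (g e) (g ((σ ^ i) e)) (g ((σ ^ j) e))) (e : E) :
    ∃! f, g (σ f) < g f ∧ σ.SameCycle f e := by
  -- Two descents on one cycle are impossible: after the first, cyclic order forces the value at `(σ
  -- ^ k) f` below that at `f`. A second drop there either returns to `f`, against this inequality,
  -- or makes `f`, `(σ ^ k) f`, `(σ ^ (k + 1)) f` decreasing.
  have hno : ∀ (f : E) (k : ℕ), 0 < k → (∀ m, 0 < m → m ≤ k → (σ ^ m) f ≠ f) →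
      g (σ f) < g f → g (σ ((σ ^ k) f)) < g ((σ ^ k) f) → False := by
    intro f k hk hm h1 h2
    have h3 : g ((σ ^ k) f) < g f := by
      rcases (Nat.succ_le_of_lt hk).eq_or_lt with rfl | hk1
      · simpa using h1
      · rcases hcyc f 1 k one_pos hk1 hm with ⟨h, -⟩ | ⟨-, h⟩ | ⟨-, h⟩
        · rw [pow_one] at h; linarith
        · exact h
        · rw [pow_one] at h; linarith
    have hsucc : σ ((σ ^ k) f) = (σ ^ (k + 1)) f := by rw [pow_succ', Equiv.Perm.mul_apply]
    by_cases hret : (σ ^ (k + 1)) f = f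
    · rw [hsucc, hret] at h2
      linarith
    · rw [hsucc] at h2
      have hm' : ∀ m, 0 < m → m ≤ k + 1 → (σ ^ m) f ≠ f := by
        intro m h0 hle
        rcases hle.eq_or_lt with rfl | hlt
        · exact hret
        · exact hm m h0 (by omega)
      rcases hcyc f k (k + 1) hk (Nat.lt_succ_self k) hm' with ⟨h, -⟩ | ⟨h, -⟩ | ⟨-, h⟩ <;> linarith
  have hfin : {f | σ.SameCycle f e}.Finite := Set.toFinite _
  -- A maximum of `g` on the cycle is a descent.
  obtain ⟨f, hf, hmax⟩ := hfin.exists_maximalFor g _ ⟨e, Equiv.Perm.SameCycle.refl _ _⟩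
  refine ⟨f, ⟨?_, hf⟩, ?_⟩
  · have hs : σ.SameCycle (σ f) e := Equiv.Perm.sameCycle_apply_left.2 hf
    rcases le_total (g f) (g (σ f)) with h | h
    · exact lt_of_le_of_ne (hmax hs h) (hne f)
    · exact lt_of_le_of_ne h (hne f)
  · rintro f' ⟨hf', hs'⟩
    by_contra hff
    have hdesc := lt_of_le_of_ne (by
      rcases le_total (g f) (g (σ f)) with h | h
      · exact hmax (Equiv.Perm.sameCycle_apply_left.2 hf) h
      · exact h) (hne f)
    have hex : ∃ k : ℕ, (σ ^ k) f = f' := by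
      obtain ⟨i, hi⟩ := (hf.trans hs'.symm).exists_nat_pow_eq
      exact ⟨i, hi⟩
    -- With the least exponent leading from `f` to `f'`, the orbit does not return to `f` on the
    -- way; a return could be cut out.
    classical
    have hk := Nat.find_spec hex
    have hmin : ∀ m, m < Nat.find hex → (σ ^ m) f ≠ f' := fun m hm => Nat.find_min hex hm
    set k := Nat.find hex
    have hk0 : 0 < k := by
      rcases Nat.eq_zero_or_pos k with h | h
      · rw [h] at hk; exact absurd hk.symm hff
      · exact h
    refine hno f k hk0 (fun m h0 hmk hret => ?_) hdesc (by rw [hk]; exact hf')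
    apply hmin (k - m) (by omega)
    have : (σ ^ (k - m)) ((σ ^ m) f) = f' := by
      rw [← Equiv.Perm.mul_apply, ← pow_add, Nat.sub_add_cancel hmk, hk]
    rwa [hret] at this

end BraneTiling

/-! ### Zig-zag paths, potentials and extremal matchings -/

namespace BipartiteMap

variable {E : Type*} {G : BipartiteMap E}

/-- Edge weights for which all perfect matchings have the same weight come from a node potential,
if all edges belong to perfect matchings. -/
theorem exists_potential_eq [Fintype E] (M₀ : G.PerfectMatching)
    (hcov : ∀ e, ∃ M : G.PerfectMatching, e ∈ M.1) (w : E → ℤ) (m : ℤ)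
    (hw : ∀ M : G.PerfectMatching, ∑ e ∈ M.1, w e = m) :
    ∃ (a : G.White → ℤ) (b : G.Black → ℤ),
      (∀ e, a (G.white e) + b (G.black e) = w e) ∧ ∑ v, a v + ∑ v, b v = m := by
  obtain ⟨a, b, M, hab, hM⟩ := exists_potential M₀ w
  rw [hw] at hM
  refine ⟨a, b, fun e => ?_, hM.symm⟩
  obtain ⟨M', he⟩ := hcov e
  have h1 : ∑ f ∈ M'.1, (a (G.white f) + b (G.black f)) = m := by
    rw [← sum_ind_mul]
    simp only [mul_add, Finset.sum_add_distrib, M'.isRegular_ind.sum_mul_white,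
      M'.isRegular_ind.sum_mul_black, one_mul, hM]
  -- Complementary slackness: the matching through `e` is optimal too, so the potential is tight on
  -- all its edges.
  exact (Finset.sum_eq_sum_iff_of_le fun f _ => hab f).1 (h1.trans (hw M').symm) e he

theorem white_eq_iff {e f : E} : G.white e = G.white f ↔ G.σW.SameCycle e f :=
  Quotient.eq (r := Equiv.Perm.SameCycle.setoid G.σW)

theorem black_eq_iff {e f : E} : G.black e = G.black f ↔ G.σB.SameCycle e f :=
  Quotient.eq (r := Equiv.Perm.SameCycle.setoid G.σB)

theorem zigzag_σB (e : E) : G.zigzag (G.σB e) = G.σW e := by simp [zigzag]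

/-- Weights counting the passages of a union of zig-zag paths annihilate boundaries. -/
theorem sum_faceBoundary_mul_eq_zero [Fintype E] {z : E → ℤ} (hz : ∀ e, z (G.zigzag e) = z e)
    {h : E → ℤ} (hh : G.IsFaceFunction h) :
    ∑ e, G.faceBoundary h e * (z e + z (G.σB e)) = 0 := by
  have hz' : ∀ e, z (G.σW e) = z (G.σB e) := fun e => by rw [← zigzag_σB, hz]
  have h1 : ∑ e, h (G.σB.symm e) * (z e + z (G.σB e)) =
      ∑ e, h e * (z (G.σB e) + z (G.σB (G.σB e))) := by
    rw [← Equiv.sum_comp G.σB]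
    simp
  have h2 : ∑ e, h e * z e = ∑ e, h e * z (G.σB (G.σB e)) := by
    rw [← Equiv.sum_comp (G.σW * G.σB)]
    refine Finset.sum_congr rfl fun e _ => ?_
    rw [Equiv.Perm.mul_apply, hh e, hz']
  simp only [faceBoundary, sub_mul, Finset.sum_sub_distrib]
  rw [h1]
  simp only [mul_add, Finset.sum_add_distrib]
  rw [h2]
  ring

end BipartiteMap

namespace BraneTiling

variable {E : Type*} [Fintype E] {T : BraneTiling E}

/-- If the weights counting the passages of a union of zig-zag paths come from a node potential, then
the zig-zag paths are null-homologous. -/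
theorem sum_smul_eq_zero_of_potential {z : E → ℤ} (hz : ∀ e, z (T.zigzag e) = z e)
    {a : T.White → ℤ} {b : T.Black → ℤ}
    (hab : ∀ e, a (T.white e) + b (T.black e) = z e + z (T.σB e)) :
    ∑ e, z e • (T.crossing e - T.crossing (T.σB.symm e)) = 0 := by
  have hz' : ∀ e, z (T.σW e) = z (T.σB e) := fun e => by rw [← BipartiteMap.zigzag_σB, hz]
  -- The boundary of this function at `e` is `z e - z (T.σB e)`, the signed passage count of the
  -- zig-zag paths. Its invariance along faces comes from comparing the potential on `e`, `T.σB e`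
  -- and `T.σW (T.σB e)`.
  have hface : T.IsFaceFunction fun e => b (T.black e) - z (T.σB e) := by
    intro e
    have h1 := hab e
    have h2 := hab (T.σB e)
    have h3 := hab (T.σW (T.σB e))
    rw [BipartiteMap.white_σW, hz'] at h3
    rw [BipartiteMap.black_σB] at h2
    simp only
    linarith
  have h1 := T.boundary_eq_zero _ hface
  have h2 : ∑ e, z e • T.crossing (T.σB.symm e) = ∑ e, z (T.σB e) • T.crossing e := by
    rw [← Equiv.sum_comp T.σB]; simp
  simp only [smul_sub, Finset.sum_sub_distrib, h2]
  rw [← Finset.sum_sub_distrib, ← h1]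
  refine Finset.sum_congr rfl fun e _ => ?_
  rw [← sub_smul, BipartiteMap.faceBoundary, BipartiteMap.black_σB_symm, Equiv.apply_symm_apply]
  congr 1
  ring

open Classical in
/-- The indicator of the zig-zag path that traverses `e` from white to black. -/
def zigzagInd (T : BraneTiling E) (e f : E) : ℤ := if T.zigzag.SameCycle e f then 1 else 0

theorem zigzagInd_zigzag (e f : E) : T.zigzagInd e (T.zigzag f) = T.zigzagInd e f := by
  classical
  unfold zigzagInd
  exact if_congr Equiv.Perm.sameCycle_apply_right rfl rfl

theorem winding_eq (e : E) :
    T.winding e = ∑ f, T.zigzagInd e f • (T.crossing f - T.crossing (T.σB.symm f)) := by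
  classical
  rw [winding, Finset.sum_filter]
  refine Finset.sum_congr rfl fun f _ => ?_
  unfold zigzagInd
  split_ifs <;> simp

theorem winding_congr {e f : E} (h : T.zigzag.SameCycle e f) : T.winding e = T.winding f := by
  classical
  rw [winding, winding]
  refine Finset.sum_congr (Finset.filter_congr fun g _ => ?_) fun _ _ => rfl
  exact ⟨fun h' => h.symm.trans h', fun h' => h.trans h'⟩

theorem winding_σW (e : E) : T.winding (T.σW e) = T.winding (T.σB e) :=
  winding_congr (Equiv.Perm.SameCycle.symm ⟨1, by rw [zpow_one, BipartiteMap.zigzag_σB]⟩)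

/-- In a consistent tiling, each zig-zag path is met by some perfect matching at each passage through
a black node, in the edge that it traverses from black to white. -/
theorem IsConsistent.exists_matching_zigzag (hT : T.IsConsistent) (e₁ : E) :
    ∃ M : T.PerfectMatching, ∀ f, T.zigzag.SameCycle e₁ f → T.σB.symm f ∈ M.1 := by
  classical
  obtain ⟨ε, hW, hB⟩ := hT.properly_ordered
  -- The matching consists of the edges at which the angle drops from `e` to the next edge. As `T.σW
  -- e` and `T.σB e` lie on the same zig-zag path, the drops around white and around black nodes are
  -- the same edges.
  set g : E → ℝ := fun e => turn ε (T.winding e₁) (T.winding e) with hg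
  have hneB : ∀ e, g (T.σB e) ≠ g e := fun e => (turn_ne _ (hT.winding_ne_zero _)
    (hT.winding_ne_zero _) (hT.direction_ne e)).symm
  have hgW : ∀ e, g (T.σW e) = g (T.σB e) := fun e => by simp only [hg, winding_σW]
  have huB := existsUnique_descent T.σB g hneB
    fun e i j hi hij h => (hB e i j hi hij h).cyclicLT _
  have huW := existsUnique_descent T.σW g (fun e => by rw [hgW]; exact hneB e)
    fun e i j hi hij h => (hW e i j hi hij h).cyclicLT _
  refine ⟨⟨Finset.univ.filter fun e => g (T.σB e) < g e, fun v => ?_, fun v => ?_⟩, fun f hf => ?_⟩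
  · obtain ⟨e, rfl⟩ := Quotient.exists_rep v
    change ∃! f, f ∈ _ ∧ T.white f = T.white e
    simpa [BipartiteMap.white_eq_iff, hgW] using huW e
  · obtain ⟨e, rfl⟩ := Quotient.exists_rep v
    change ∃! f, f ∈ _ ∧ T.black f = T.black e
    simpa [BipartiteMap.black_eq_iff] using huB e
  · simp only [Finset.mem_filter, Finset.mem_univ, true_and, Equiv.apply_symm_apply]
    -- Angles are measured from the direction of the given path, so its own value is the minimum and
    -- the step into it is a drop.
    refine lt_of_le_of_ne ?_ ?_
    · simp only [hg, ← winding_congr hf, turn_self]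
      exact le_turn _ _ _
    · have := hneB (T.σB.symm f)
      rwa [Equiv.apply_symm_apply] at this

theorem IsConsistent.exists_mem (hT : T.IsConsistent) (e : E) :
    ∃ M : T.PerfectMatching, e ∈ M.1 := by
  obtain ⟨M, hM⟩ := hT.exists_matching_zigzag (T.σB e)
  exact ⟨M, by simpa using hM _ (Equiv.Perm.SameCycle.refl _ _)⟩

theorem sum_ind_mul_zigzag (M : T.PerfectMatching) (z : E → ℤ) :
    ∑ e, M.ind e * (z e + z (T.σB e)) = ∑ f, z f * (M.ind f + M.ind (T.σB.symm f)) := by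
  have : ∑ e, M.ind e * z (T.σB e) = ∑ f, z f * M.ind (T.σB.symm f) := by
    rw [← Equiv.sum_comp T.σB (fun f => z f * _)]
    simp [mul_comm]
  simp only [mul_add, Finset.sum_add_distrib, this]
  simp only [mul_comm]

theorem ind_add_ind_le (M : T.PerfectMatching) {f : E} (hf : T.σB.symm f ≠ f) :
    M.ind f + M.ind (T.σB.symm f) ≤ 1 := by
  classical
  have : ¬ (f ∈ M.1 ∧ T.σB.symm f ∈ M.1) := fun ⟨h1, h2⟩ =>
    hf ((M.2.2 (T.black f)).unique ⟨h2, BipartiteMap.black_σB_symm f⟩ ⟨h1, rfl⟩)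
  unfold BipartiteMap.PerfectMatching.ind
  split_ifs <;> simp_all

/-- A linear form that is nonpositive on the Newton polygon vanishes if the origin is an interior
point. -/
theorem eq_zero_of_height_nonpos (M₀ : T.PerfectMatching)
    (hM₀ : (0 : Fin 2 → ℝ) ∈ interior (T.newtonPolygon M₀)) (φ : Fin 2 → ℤ)
    (h : ∀ M, ∑ j, T.height M₀ M j * φ j ≤ 0) : φ = 0 := by
  have hsub : T.newtonPolygon M₀ ⊆ {y | ∑ j, y j * (φ j : ℝ) ≤ 0} := by
    refine convexHull_min ?_ ?_
    · rintro _ ⟨M, rfl⟩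
      have := h M
      simp only [Set.mem_ofPred_eq]
      exact_mod_cast this
    · have hl : IsLinearMap ℝ fun y : Fin 2 → ℝ => ∑ j, y j * (φ j : ℝ) :=
        ⟨fun x y => by simp [add_mul]; ring, fun c x => by simp [mul_add, mul_assoc]⟩
      exact convex_halfSpace_le hl 0
  -- A small positive multiple of `φ` itself lies in the polygon, and there the form takes the value
  -- δ|φ|².
  have hcont : Filter.Tendsto (fun δ : ℝ => δ • (fun j => (φ j : ℝ))) (nhdsWithin 0 (Set.Ioi 0))
      (nhds 0) := by
    have : Continuous fun δ : ℝ => δ • (fun j => (φ j : ℝ)) := by fun_prop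
    have h0 := this.tendsto 0
    rw [zero_smul] at h0
    exact h0.mono_left nhdsWithin_le_nhds
  obtain ⟨δ, hδ, hpos⟩ := ((hcont.eventually_mem
    (mem_interior_iff_mem_nhds.1 hM₀)).and self_mem_nhdsWithin).exists
  have h1 : ∑ j, (δ • (fun j => (φ j : ℝ))) j * (φ j : ℝ) ≤ 0 := hsub hδ
  simp only [Pi.smul_apply, smul_eq_mul, Fin.sum_univ_two] at h1
  have hpos' : (0 : ℝ) < δ := hpos
  have h2 : (φ 0 : ℝ) * φ 0 + φ 1 * φ 1 ≤ 0 := by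
    by_contra hc
    nlinarith
  ext j
  fin_cases j
  · have : (φ 0 : ℝ) = 0 := by nlinarith
    exact_mod_cast this
  · have : (φ 1 : ℝ) = 0 := by nlinarith
    exact_mod_cast this

/-- In a consistent tiling, each edge belongs to a perfect matching on the boundary of the Newton
polygon. -/
theorem IsConsistent.exists_mem_rmatching (hT : T.IsConsistent) (M₀ : T.PerfectMatching)
    (hM₀ : (0 : Fin 2 → ℝ) ∈ interior (T.newtonPolygon M₀)) (e₀ : E) :
    ∃ M : T.RMatching M₀, e₀ ∈ M.1.1 := by
  classical
  obtain ⟨M, hM⟩ := hT.exists_matching_zigzag (T.σB e₀)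
  have he₀ : e₀ ∈ M.1 := by simpa using hM _ (Equiv.Perm.SameCycle.refl _ _)
  refine ⟨⟨M, fun hzero => ?_⟩, he₀⟩
  set z := T.zigzagInd (T.σB e₀) with hz
  have hzz : ∀ e, z (T.zigzag e) = z e := zigzagInd_zigzag _
  have hz0 : ∀ e, 0 ≤ z e := fun e => by
    rw [hz]; unfold zigzagInd; split_ifs <;> norm_num
  have hfix : ∀ f, T.σB.symm f ≠ f := fun f h => by
    have h2 := hT.direction_ne f
    rw [show T.σB f = f by conv_lhs => rw [← h, Equiv.apply_symm_apply]] at h2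
    exact h2 (SameRay.refl _)
  -- `ψ` counts the passages of the zig-zag path through the edges. It kills boundaries, so on
  -- 1-cycles it is a linear function of the homology class.
  set ψ : (E → ℤ) → ℤ := fun x => ∑ e, x e * (z e + z (T.σB e)) with hψ
  have hψ_sub : ∀ x y, ψ (x - y) = ψ x - ψ y := fun x y => by
    simp [hψ, sub_mul, Finset.sum_sub_distrib]
  have hψ_add : ∀ x y, ψ (x + y) = ψ x + ψ y := fun x y => by
    simp [hψ, add_mul, Finset.sum_add_distrib]
  have hψ_smul : ∀ (c : ℤ) x, ψ (c • x) = c * ψ x := fun c x => by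
    simp [hψ, mul_assoc, Finset.mul_sum]
  have hψ0 : ∀ x, T.IsOneCycle x → T.pairing x = 0 → ψ x = 0 := by
    intro x hx hp
    obtain ⟨h, hh, rfl⟩ := T.exists_boundary x hx hp
    exact BipartiteMap.sum_faceBoundary_mul_eq_zero hzz hh
  -- The edges `T.σB.symm f` and `f` share a black node, so a matching contains at most one of them;
  -- `M` contains the former at every passage.
  have hle : ∀ M' : T.PerfectMatching, ψ M'.ind ≤ ψ M.ind := by
    intro M'
    simp only [hψ, sum_ind_mul_zigzag]
    refine Finset.sum_le_sum fun f _ => ?_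
    by_cases hf : T.zigzag.SameCycle (T.σB e₀) f
    · have h1 : M.ind (T.σB.symm f) = 1 := by
        simp [BipartiteMap.PerfectMatching.ind, hM f hf]
      have h2 := M.ind_nonneg f
      have h3 := ind_add_ind_le M' (hfix f)
      exact mul_le_mul_of_nonneg_left (by linarith) (hz0 f)
    · have : z f = 0 := by rw [hz]; simp [zigzagInd, hf]
      simp [this]
  have hcyc : ∀ M' : T.PerfectMatching, T.IsRegular (M'.ind - M₀.ind) 0 := fun M' => by
    simpa using M'.isRegular_ind.sub M₀.isRegular_ind
  have hh : ∀ M', T.pairing (M'.ind - M₀.ind) = T.height M₀ M' := fun M' => by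
    rw [pairing_sub, height_eq]
  obtain ⟨x₀, hx₀, hp₀⟩ := T.exists_cycle (Pi.single 0 1)
  obtain ⟨x₁, hx₁, hp₁⟩ := T.exists_cycle (Pi.single 1 1)
  have hlin : ∀ x, T.IsOneCycle x → ψ x = T.pairing x 0 * ψ x₀ + T.pairing x 1 * ψ x₁ := by
    intro x hx
    have h1 : T.IsRegular (x - (T.pairing x 0 • x₀ + T.pairing x 1 • x₁)) 0 := by
      have := BipartiteMap.IsRegular.sub hx ((BipartiteMap.IsRegular.smul (T.pairing x 0) hx₀).add
        (BipartiteMap.IsRegular.smul (T.pairing x 1) hx₁))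
      simpa using this
    have h2 := hψ0 _ h1 (by
      rw [pairing_sub, pairing_add, pairing_smul, pairing_smul,
        show T.pairing x₀ = _ from hp₀, show T.pairing x₁ = _ from hp₁]
      ext j
      fin_cases j <;> simp)
    rw [hψ_sub, hψ_add, hψ_smul, hψ_smul] at h2
    linarith
  have hM0 : ψ M.ind = ψ M₀.ind := by
    have := hψ0 _ (hcyc M) (by rw [hh, hzero])
    rw [hψ_sub] at this
    linarith
  -- If `M` has height zero, the maximum of `ψ` is attained at the origin, an interior point, so the
  -- induced form on heights vanishes.
  have hφ := eq_zero_of_height_nonpos M₀ hM₀ ![ψ x₀, ψ x₁] (fun M' => by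
    have h1 := hlin _ (hcyc M')
    rw [hψ_sub, hh] at h1
    have h2 := hle M'
    simp only [Fin.sum_univ_two, Matrix.cons_val_zero, Matrix.cons_val_one]
    linarith)
  have hφ0 : ψ x₀ = 0 := congrFun hφ 0
  have hφ1 : ψ x₁ = 0 := congrFun hφ 1
  obtain ⟨a, b, hab, -⟩ := BipartiteMap.exists_potential_eq M₀ hT.exists_mem
    (fun e => z e + z (T.σB e)) (ψ M₀.ind) (fun M' => by
      rw [← BipartiteMap.sum_ind_mul]
      have h1 := hlin _ (hcyc M')
      rw [hψ_sub, hφ0, hφ1] at h1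
      simp only [hψ] at h1
      simp only [hψ]
      linarith)
  refine hT.winding_ne_zero (T.σB e₀) ?_
  rw [winding_eq]
  exact sum_smul_eq_zero_of_potential hzz hab

end BraneTiling

/-! ### Generation of the F-term charges by the period relations -/

/-- An integral homogeneous system with a positive real solution has a positive integral one. -/
theorem exists_nat_pos_of_exists_real_pos {ι κ : Type*} [Fintype ι] [Finite κ] (h : ι → κ → ℤ)
    (t : ι → ℝ) (ht : ∀ i, 0 < t i) (hsum : ∀ j, ∑ i, t i * h i j = 0) :
    ∃ l : ι → ℕ, (∀ i, 0 < l i) ∧ ∑ i, (l i : ℤ) • h i = 0 := by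
  classical
  -- After scaling by `K`, each floor ⌊n K t_i⌋ strictly increases with n, which later makes the
  -- solution positive.
  obtain ⟨K, hK⟩ : ∃ K : ℕ, ∀ i, 1 ≤ K * t i := by
    refine ⟨∑ i, ⌈1 / t i⌉₊, fun i => ?_⟩
    have h1 : (1 / t i) ≤ ((∑ i, ⌈1 / t i⌉₊ : ℕ) : ℝ) := (Nat.le_ceil _).trans (by
      exact_mod_cast Finset.single_le_sum (f := fun i => ⌈1 / t i⌉₊) (fun _ _ => Nat.zero_le _)
        (Finset.mem_univ i))
    rwa [div_le_iff₀ (ht i)] at h1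
  set F : ℕ → κ → ℤ := fun n j => ∑ i, ⌊n * (K * t i)⌋ * h i j with hF
  set B : κ → ℤ := fun j => ∑ i, |h i j| with hB
  -- The exact combination vanishes, so `F n` only involves fractional parts and is bounded
  -- independently of n. Two values therefore coincide, and the difference of the floors solves the
  -- system.
  have hmem : ∀ n, F n ∈ Set.Icc (-B) B := by
    intro n
    have key : ∀ j, |F n j| ≤ B j := by
      intro j
      have h1 : ((F n j : ℤ) : ℝ) = -∑ i, Int.fract (n * (K * t i)) * h i j := by
        have h2 : ∑ i, (n * (K * t i)) * (h i j : ℝ) = 0 := by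
          rw [← mul_zero ((n : ℝ) * K), ← hsum j, Finset.mul_sum]
          exact Finset.sum_congr rfl fun i _ => by ring
        simp only [hF, Int.fract, sub_mul, Finset.sum_sub_distrib, h2]
        push_cast
        ring
      have h3 : |((F n j : ℤ) : ℝ)| ≤ (B j : ℝ) := by
        rw [h1, abs_neg]
        refine (Finset.abs_sum_le_sum_abs _ _).trans ?_
        rw [hB]
        push_cast
        refine Finset.sum_le_sum fun i _ => ?_
        rw [abs_mul, abs_of_nonneg (Int.fract_nonneg _)]
        exact mul_le_of_le_one_left (abs_nonneg _) (Int.fract_lt_one _).le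
      exact_mod_cast h3
    exact ⟨fun j => (abs_le.1 (key j)).1, fun j => (abs_le.1 (key j)).2⟩
  have hninj : ¬ Function.Injective F := by
    intro hinj
    have := Fintype.ofFinite κ
    exact Set.infinite_of_injective_forall_mem hinj hmem (Set.finite_Icc (-B) B)
  obtain ⟨n₁, n₂, heq, hlt⟩ : ∃ n₁ n₂, F n₁ = F n₂ ∧ n₁ < n₂ := by
    simp only [Function.Injective, not_forall] at hninj
    obtain ⟨a, b, hab, hne⟩ := hninj
    rcases lt_or_gt_of_ne hne with hl | hl
    exacts [⟨a, b, hab, hl⟩, ⟨b, a, hab.symm, hl⟩]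
  have hpos : ∀ i, 0 < ⌊n₂ * (K * t i)⌋ - ⌊n₁ * (K * t i)⌋ := by
    intro i
    have h1 : ⌊n₁ * (K * t i)⌋ + 1 ≤ ⌊n₂ * (K * t i)⌋ := by
      rw [← Int.floor_add_one]
      refine Int.floor_le_floor ?_
      have h2 : (n₁ : ℝ) + 1 ≤ n₂ := by exact_mod_cast hlt
      nlinarith [hK i]
    linarith
  refine ⟨fun i => (⌊n₂ * (K * t i)⌋ - ⌊n₁ * (K * t i)⌋).toNat, fun i => ?_, ?_⟩
  · exact Int.lt_toNat.2 (by simpa using hpos i)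
  · ext j
    have h1 := congrFun heq j
    have h2 : ∀ i, (((⌊n₂ * (K * t i)⌋ - ⌊n₁ * (K * t i)⌋).toNat : ℕ) : ℤ) =
        ⌊n₂ * (K * t i)⌋ - ⌊n₁ * (K * t i)⌋ := fun i => Int.toNat_of_nonneg (hpos i).le
    simp only [h2, Finset.sum_apply, Pi.smul_apply, smul_eq_mul, sub_mul, Finset.sum_sub_distrib,
      Pi.zero_apply]
    simp only [hF] at h1
    linarith

namespace BraneTiling

variable {E : Type*} [Fintype E] {T : BraneTiling E}

theorem nonempty_edges (T : BraneTiling E) : Nonempty E := by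
  by_contra h
  rw [not_nonempty_iff] at h
  obtain ⟨x, -, hx⟩ := T.exists_cycle 1
  simp at hx

/-- The point -δ times the sum of all heights lies in the polygon for small δ > 0. Adding δ to each
of its nonnegative coefficients gives positive coefficients with sum zero; their normalization is
irrelevant. -/
theorem exists_pos_real (M₀ : T.PerfectMatching)
    (hM₀ : (0 : Fin 2 → ℝ) ∈ interior (T.newtonPolygon M₀)) :
    ∃ t : T.PerfectMatching → ℝ, (∀ M, 0 < t M) ∧ ∀ j, ∑ M, t M * T.height M₀ M j = 0 := by
  classical
  have hsub : T.newtonPolygon M₀ ⊆ {y | ∃ w : T.PerfectMatching → ℝ, (∀ M, 0 ≤ w M) ∧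
      ∀ j, ∑ M, w M * T.height M₀ M j = y j} := by
    refine convexHull_min ?_ ?_
    · rintro _ ⟨M, rfl⟩
      refine ⟨Pi.single M 1, fun M' => ?_, fun j => ?_⟩
      · by_cases h : M' = M
        · subst h; simp
        · simp [h]
      · rw [Finset.sum_eq_single M]
        · simp
        · intro b _ hb; simp [hb]
        · simp
    · rintro y ⟨w, hw, hy⟩ y' ⟨w', hw', hy'⟩ a b ha hb -
      refine ⟨fun M => a * w M + b * w' M, fun M => ?_, fun j => ?_⟩
      · exact add_nonneg (mul_nonneg ha (hw M)) (mul_nonneg hb (hw' M))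
      · simp only [Pi.add_apply, Pi.smul_apply, smul_eq_mul, ← hy, ← hy', Finset.mul_sum,
          ← Finset.sum_add_distrib]
        exact Finset.sum_congr rfl fun M _ => by ring
  set y : Fin 2 → ℝ := fun j => ∑ M, (T.height M₀ M j : ℝ)
  have hcont : Filter.Tendsto (fun δ : ℝ => δ • -y) (nhdsWithin 0 (Set.Ioi 0)) (nhds 0) := by
    have : Continuous fun δ : ℝ => δ • -y := by fun_prop
    have h0 := this.tendsto 0
    rw [zero_smul] at h0
    exact h0.mono_left nhdsWithin_le_nhds
  obtain ⟨δ, hδ, hpos⟩ := ((hcont.eventually_mem (mem_interior_iff_mem_nhds.1 hM₀)).and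
    self_mem_nhdsWithin).exists
  obtain ⟨w, hw, hwy⟩ := hsub hδ
  have hpos' : (0 : ℝ) < δ := hpos
  refine ⟨fun M => w M + δ, fun M => add_pos_of_nonneg_of_pos (hw M) hpos', fun j => ?_⟩
  simp only [add_mul, Finset.sum_add_distrib, hwy, ← Finset.mul_sum]
  simp [y]

theorem sum_matching_eq {A : Type*} [AddCommMonoid A] (M₀ : T.PerfectMatching)
    (f : T.PerfectMatching → A) :
    ∑ M, f M = ∑ j : T.SMatching M₀, f j.1 + ∑ i : T.RMatching M₀, f i.1 := by
  classical
  have h1 : ∑ j : T.SMatching M₀, f j.1 = ∑ j : {M // T.height M₀ M = 0}, f j :=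
    Fintype.sum_equiv
      (show T.SMatching M₀ ≃ {M // T.height M₀ M = 0} from Equiv.refl (T.SMatching M₀)) _ _
      fun _ => rfl
  have h2 : ∑ i : T.RMatching M₀, f i.1 = ∑ i : {M // ¬ T.height M₀ M = 0}, f i :=
    Fintype.sum_equiv
      (show T.RMatching M₀ ≃ {M // ¬ T.height M₀ M = 0} from Equiv.refl (T.RMatching M₀)) _ _
      fun _ => rfl
  rw [h1, h2]
  have h3 := Fintype.sum_subtype_add_sum_subtype (fun M => T.height M₀ M = 0) f
  exact h3.symm

theorem mem_fTermCharges {c : T.PerfectMatching → ℤ} :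
    c ∈ T.fTermCharges ↔ ∀ e, ∑ M, c M * M.ind e = 0 := by
  classical
  rw [fTermCharges, LinearMap.mem_ker, funext_iff]
  refine forall_congr' fun e => ?_
  simp [Matrix.mulVec, dotProduct, matchingMatrix, BipartiteMap.PerfectMatching.ind]

/-- Each matching has exactly one edge at a given node, so summing the edge relations there counts
each coefficient once. -/
theorem sum_eq_zero_of_mem_fTermCharges {c : T.PerfectMatching → ℤ} (hc : c ∈ T.fTermCharges) :
    ∑ M, c M = 0 := by
  obtain ⟨e⟩ := T.nonempty_edges
  have := (isRegular_sum_ind (fun M => M) c).1 (T.white e)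
  simpa [mem_fTermCharges.1 hc] using this.symm

theorem sum_smul_height_of_mem_fTermCharges (M₀ : T.PerfectMatching) {c : T.PerfectMatching → ℤ}
    (hc : c ∈ T.fTermCharges) : ∑ M, c M • T.height M₀ M = 0 := by
  have := pairing_sum_ind M₀ (fun M => M) c
  rw [sum_eq_zero_of_mem_fTermCharges hc, zero_smul, add_zero,
    funext (mem_fTermCharges.1 hc)] at this
  rw [← this]
  simp [pairing]

theorem periodRelations_subset (M₀ : T.PerfectMatching) :
    T.periodRelations M₀ ⊆ T.fTermCharges := by
  rintro c ⟨n, l, l', -, hreg, hR, hS⟩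
  rw [regroups_iff] at hreg
  refine mem_fTermCharges.2 fun e => ?_
  rw [sum_matching_eq M₀]
  simp only [hR, hS, hreg e, neg_mul, Finset.sum_neg_distrib, neg_add_cancel]

/-- A charge has total height zero and the `s`-matchings contribute nothing to it, so the
`r`-entries form an exponent of some `f_n`. -/
theorem mem_periodRelations (M₀ : T.PerfectMatching) {c : T.PerfectMatching → ℤ}
    (hc : c ∈ T.fTermCharges) (hR : ∀ i : T.RMatching M₀, 0 ≤ c i.1)
    (hS : ∀ j : T.SMatching M₀, c j.1 ≤ 0) : c ∈ T.periodRelations M₀ := by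
  have hl : ∀ i : T.RMatching M₀, (((Finsupp.equivFunOnFinite.symm
      fun i : T.RMatching M₀ => (c i.1).toNat) i : ℕ) : ℤ) = c i.1 := fun i =>
    Int.toNat_of_nonneg (hR i)
  have hl' : ∀ j : T.SMatching M₀, (((-c j.1).toNat : ℕ) : ℤ) = -c j.1 := fun j =>
    Int.toNat_of_nonneg (neg_nonneg.2 (hS j))
  refine ⟨_, Finsupp.equivFunOnFinite.symm fun i => (c i.1).toNat, fun j => (-c j.1).toNat,
    (coeff_support_iff M₀ _ _).2 ⟨rfl, ?_⟩, (regroups_iff M₀ _ _).2 fun e => ?_,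
    fun i => (hl i).symm, fun j => by rw [hl', neg_neg]⟩
  · have := sum_smul_height_of_mem_fTermCharges M₀ hc
    rw [sum_matching_eq M₀, Finset.sum_eq_zero (fun j _ => by rw [j.2, smul_zero]), zero_add] at this
    simpa only [hl] using this
  · have := mem_fTermCharges.1 hc e
    rw [sum_matching_eq M₀] at this
    simp only [hl, hl', neg_mul, Finset.sum_neg_distrib]
    linarith

/-- There is a relation in which each `r`-matching and each `s`-matching takes part. -/
theorem IsConsistent.exists_relation (hT : T.IsConsistent) (M₀ : T.PerfectMatching)
    (hM₀ : (0 : Fin 2 → ℝ) ∈ interior (T.newtonPolygon M₀)) :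
    ∃ c ∈ T.fTermCharges, (∀ i : T.RMatching M₀, 0 < c i.1) ∧
      ∀ j : T.SMatching M₀, c j.1 < 0 := by
  classical
  obtain ⟨t, ht, hsum⟩ := exists_pos_real M₀ hM₀
  obtain ⟨l, hl, hlsum⟩ := exists_nat_pos_of_exists_real_pos (fun M => T.height M₀ M) t ht hsum
  -- Every edge lies in an `r`-matching, whose coefficient is now larger than the number of
  -- `s`-matchings; all of these can be subtracted once without making an edge negative.
  set K : ℤ := Fintype.card (T.SMatching M₀) + 1 with hK
  have hKpos : 0 < K := by positivity
  set c₀ : T.PerfectMatching → ℤ := fun M => if T.height M₀ M = 0 then -1 else K * l M with hc₀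
  have hcS : ∀ j : T.SMatching M₀, c₀ j.1 = -1 := fun j => if_pos j.2
  have hcR : ∀ i : T.RMatching M₀, c₀ i.1 = K * l i.1 := fun i => if_neg i.2
  have hreg := isRegular_sum_ind (T := T) (fun M => M) c₀
  have hnonneg : ∀ e, 0 ≤ ∑ M, c₀ M * M.ind e := by
    intro e
    obtain ⟨i, hi⟩ := hT.exists_mem_rmatching M₀ hM₀ e
    rw [sum_matching_eq M₀]
    simp only [hcS, hcR]
    have h1 : ∑ j : T.SMatching M₀, -1 * j.1.ind e ≥ ∑ j : T.SMatching M₀, (-1 : ℤ) := by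
      refine Finset.sum_le_sum fun j _ => ?_
      unfold BipartiteMap.PerfectMatching.ind
      split_ifs <;> norm_num
    have h2 : K * l i.1 * i.1.ind e ≤ ∑ i : T.RMatching M₀, K * l i.1 * i.1.ind e :=
      Finset.single_le_sum (f := fun i : T.RMatching M₀ => K * l i.1 * i.1.ind e)
        (fun i _ => mul_nonneg (by positivity) (i.1.ind_nonneg e)) (Finset.mem_univ i)
    have h3 : i.1.ind e = 1 := by simp [BipartiteMap.PerfectMatching.ind, hi]
    have h4 : (1 : ℤ) ≤ l i.1 := by exact_mod_cast hl i.1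
    rw [h3, mul_one] at h2
    simp only [neg_mul, one_mul, Finset.sum_neg_distrib, Finset.sum_const, Finset.card_univ,
      nsmul_eq_mul, mul_one] at h1 ⊢
    nlinarith
  have hheight : ∑ M, c₀ M • T.height M₀ M = 0 := by
    rw [← smul_zero K, ← hlsum, Finset.smul_sum]
    refine Finset.sum_congr rfl fun M _ => ?_
    by_cases h : T.height M₀ M = 0
    · simp [h]
    · simp only [hc₀, h, if_false, mul_smul]
  obtain ⟨e₀⟩ := T.nonempty_edges
  have hn : 0 ≤ ∑ M, c₀ M := by
    rw [← hreg.1 (T.white e₀)]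
    exact Finset.sum_nonneg fun e _ => hnonneg e
  obtain ⟨n, hn⟩ := Int.eq_ofNat_of_zero_le hn
  -- The remainder regroups into `s`-matchings. The ones subtracted beforehand make every `s`-entry
  -- strictly negative, even where `l'` vanishes.
  obtain ⟨l', -, hl'⟩ := exists_eq_sum_ind_smatching M₀ n (hn ▸ hreg) hnonneg
    (by rw [pairing_sum_ind M₀ (fun M => M), hheight, hn, zero_add])
  set c : T.PerfectMatching → ℤ :=
    fun M => if h : T.height M₀ M = 0 then -1 - l' ⟨M, h⟩ else K * l M with hc
  have hcS' : ∀ j : T.SMatching M₀, c j.1 = -1 - l' j := fun j => dif_pos j.2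
  have hcR' : ∀ i : T.RMatching M₀, c i.1 = K * l i.1 := fun i => dif_neg i.2
  refine ⟨c, mem_fTermCharges.2 fun e => ?_, fun i => ?_, fun j => ?_⟩
  · have := hl' e
    rw [sum_matching_eq M₀] at this ⊢
    simp only [hcS, hcR] at this
    simp only [hcS', hcR', sub_mul, Finset.sum_sub_distrib]
    linarith
  · rw [hcR']
    have := hl i.1
    positivity
  · rw [hcS']
    have : (0 : ℤ) ≤ l' j := by positivity
    linarith

theorem IsConsistent.span_periodRelations (hT : T.IsConsistent) (M₀ : T.PerfectMatching)
    (hM₀ : (0 : Fin 2 → ℝ) ∈ interior (T.newtonPolygon M₀)) :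
    Submodule.span ℤ (T.periodRelations M₀) = T.fTermCharges := by
  refine le_antisymm (Submodule.span_le.2 (periodRelations_subset M₀)) fun c hc => ?_
  obtain ⟨y, hy, hyR, hyS⟩ := hT.exists_relation M₀ hM₀
  set N : ℤ := ∑ M, |c M|
  have hN : ∀ M, |c M| ≤ N := fun M =>
    Finset.single_le_sum (f := fun M => |c M|) (fun _ _ => abs_nonneg _) (Finset.mem_univ M)
  have hN0 : 0 ≤ N := Finset.sum_nonneg fun _ _ => abs_nonneg _
  have h1 : N • y ∈ T.periodRelations M₀ := by
    refine mem_periodRelations M₀ (Submodule.smul_mem _ _ hy) (fun i => ?_) (fun j => ?_)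
    · exact mul_nonneg hN0 (hyR i).le
    · exact mul_nonpos_of_nonneg_of_nonpos hN0 (hyS j).le
  have h2 : c + N • y ∈ T.periodRelations M₀ := by
    refine mem_periodRelations M₀ (Submodule.add_mem _ hc (Submodule.smul_mem _ _ hy))
      (fun i => ?_) (fun j => ?_)
    · have ha := hN i.1
      have hb := neg_abs_le (c i.1)
      have hd := hyR i
      simp only [Pi.add_apply, Pi.smul_apply, smul_eq_mul]
      nlinarith
    · have ha := hN j.1
      have hb := le_abs_self (c j.1)
      have hd := hyS j
      simp only [Pi.add_apply, Pi.smul_apply, smul_eq_mul]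
      nlinarith
  rw [← add_sub_cancel_right c (N • y)]
  exact Submodule.sub_mem _ (Submodule.subset_span h2) (Submodule.subset_span h1)

end BraneTiling

/-! ### The coherent component and the ring of GLSM fields -/

theorem BipartiteMap.eq_of_invariant {E α : Type*} (G : BipartiteMap E) {F : E → α}
    (hW : ∀ e, F (G.σW e) = F e) (hB : ∀ e, F (G.σB e) = F e) (e f : E) : F e = F f := by
  have := G.connected
  obtain ⟨⟨g, hg⟩, rfl⟩ := MulAction.exists_smul_eq (Subgroup.closure {G.σW, G.σB}) e f
  change F e = F (g e)
  clear this
  induction hg using Subgroup.closure_induction generalizing e with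
  | mem g hg =>
    rcases hg with rfl | hg
    · exact (hW e).symm
    · rw [Set.mem_singleton_iff.1 hg, hB]
  | one => rfl
  | mul g h _ _ ihg ihh => rw [Equiv.Perm.mul_apply, ← ihg, ← ihh]
  | inv g _ ih =>
    rw [ih (g⁻¹ e), ← Equiv.Perm.mul_apply, mul_inv_cancel, Equiv.Perm.one_apply]

namespace MvPolynomial

theorem X_mul_pderiv_prod_X {σ R : Type*} [CommRing R] [DecidableEq σ] (s : Finset σ) (e : σ) :
    (X e : MvPolynomial σ R) * pderiv e (∏ f ∈ s, X f) = if e ∈ s then ∏ f ∈ s, X f else 0 := by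
  induction s using Finset.induction_on with
  | empty => simp
  | insert f s hf ih =>
    rw [Finset.prod_insert hf, Derivation.leibniz, smul_eq_mul, smul_eq_mul, mul_add,
      mul_left_comm, ih]
    by_cases hfe : f = e
    · subst hfe
      simp [hf, mul_comm]
    · rw [pderiv_X_of_ne hfe]
      simp [Ne.symm hfe]

end MvPolynomial

namespace BraneTiling

variable {E : Type*} [Fintype E] {T : BraneTiling E}

open MvPolynomial

/-! ### The coherent ideal -/

-- The terms of the superpotential are squarefree, so `X e * pderiv e` keeps exactly the terms
-- containing `X e`, those of the two end points of `e`.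
open Classical in
theorem X_mul_pderiv_superpotential (e : E) :
    X e * pderiv e T.superpotential =
      ∏ f with T.white f = T.white e, X f - ∏ f with T.black f = T.black e, X f := by
  rw [superpotential, map_sub, map_sum, map_sum, mul_sub, Finset.mul_sum, Finset.mul_sum]
  simp only [X_mul_pderiv_prod_X, Finset.mem_filter, Finset.mem_univ, true_and]
  rw [Finset.sum_ite_eq, Finset.sum_ite_eq]
  simp

open Classical in
theorem white_sub_black_mem_fTermIdeal (e : E) :
    (∏ f with T.white f = T.white e, X f - ∏ f with T.black f = T.black e, X f :
      MvPolynomial E ℂ) ∈ T.fTermIdeal := by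
  rw [← X_mul_pderiv_superpotential]
  exact Ideal.mul_mem_left _ _ (Ideal.subset_span ⟨e, rfl⟩)

theorem fTermIdeal_le_coherentIdeal : T.fTermIdeal ≤ T.coherentIdeal := fun f hf =>
  ⟨0, by simpa using hf⟩

theorem mem_coherentIdeal_of_mul_mem {f : MvPolynomial E ℂ}
    (h : (∏ e, X e) * f ∈ T.coherentIdeal) : f ∈ T.coherentIdeal := by
  obtain ⟨n, hn⟩ := h
  exact ⟨n + 1, by rwa [pow_succ, mul_assoc]⟩

/-- The coordinate function of an edge on the coherent component. -/
def coord (T : BraneTiling E) (e : E) : MvPolynomial E ℂ ⧸ T.coherentIdeal :=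
  Ideal.Quotient.mk T.coherentIdeal (X e)

theorem prod_coord_mem_nonZeroDivisors :
    ∏ e, T.coord e ∈ nonZeroDivisors (MvPolynomial E ℂ ⧸ T.coherentIdeal) := by
  rw [mem_nonZeroDivisors_iff_right]
  intro x hx
  obtain ⟨f, rfl⟩ := Ideal.Quotient.mk_surjective x
  simp only [coord, ← map_prod, ← map_mul] at hx
  rw [Ideal.Quotient.eq_zero_iff_mem] at hx ⊢
  exact mem_coherentIdeal_of_mul_mem (by rwa [mul_comm])

-- The F-terms identify the node products at the two ends of each edge, and connectedness propagates
-- this to all nodes. The common value divides the product of all coordinates, a non-zero-divisor by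
-- saturation.
open Classical in
theorem exists_coord_node (T : BraneTiling E) :
    ∃ t ∈ nonZeroDivisors (MvPolynomial E ℂ ⧸ T.coherentIdeal),
      (∀ v, ∏ f with T.white f = v, T.coord f = t) ∧
        ∀ v, ∏ f with T.black f = v, T.coord f = t := by
  have hwb : ∀ e, ∏ f with T.white f = T.white e, T.coord f =
      ∏ f with T.black f = T.black e, T.coord f := by
    intro e
    simp only [coord, ← map_prod]
    rw [Ideal.Quotient.eq]
    exact fTermIdeal_le_coherentIdeal (white_sub_black_mem_fTermIdeal e)
  have hconst := T.toBipartiteMap.eq_of_invariant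
    (F := fun e => ∏ f with T.white f = T.white e, T.coord f)
    (fun e => by simp only [BipartiteMap.white_σW])
    (fun e => by simp only [hwb, BipartiteMap.black_σB])
  obtain ⟨e₀⟩ := T.nonempty_edges
  refine ⟨∏ f with T.white f = T.white e₀, T.coord f, ?_, fun v => ?_, fun v => ?_⟩
  · have := prod_coord_mem_nonZeroDivisors (T := T)
    rw [← Finset.prod_filter_mul_prod_filter_not Finset.univ
      (fun f => T.white f = T.white e₀)] at this
    exact (mul_mem_nonZeroDivisors.1 this).1
  · obtain ⟨e, rfl⟩ := Quotient.exists_rep v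
    exact hconst e e₀
  · obtain ⟨e, rfl⟩ := Quotient.exists_rep v
    exact (hwb e).symm.trans (hconst e e₀)

theorem prod_pow_eq {ι A : Type*} [Fintype ι] [CommMonoid A] [DecidableEq ι] (p : E → ι) (x : E → A)
    (t : A) (h : ∀ v, ∏ f with p f = v, x f = t) (k : ι → ℕ) :
    ∏ e, x e ^ k (p e) = t ^ ∑ v, k v := by
  rw [← Finset.prod_fiberwise Finset.univ p, ← Finset.prod_pow_eq_pow_sum]
  refine Finset.prod_congr rfl fun v _ => ?_
  rw [← h v, ← Finset.prod_pow]
  exact Finset.prod_congr rfl fun e he => by rw [(Finset.mem_filter.1 he).2]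

/-- The difference `u - v` is a node potential of total zero. With its positive and negative parts
moved to opposite sides, the monomials agree up to powers of the common node product; total zero
makes these powers equal, and they cancel. -/
theorem IsConsistent.prod_coord_eq (hT : T.IsConsistent) (M₀ : T.PerfectMatching) {u v : E → ℕ}
    (huv : ∀ M : T.PerfectMatching, ∑ e ∈ M.1, u e = ∑ e ∈ M.1, v e) :
    ∏ e, T.coord e ^ u e = ∏ e, T.coord e ^ v e := by
  classical
  obtain ⟨a, b, hab, hsum⟩ := BipartiteMap.exists_potential_eq M₀ hT.exists_mem
    (fun e => (u e : ℤ) - v e) 0 (fun M => by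
      rw [Finset.sum_sub_distrib, sub_eq_zero]
      exact_mod_cast huv M)
  obtain ⟨t, ht, htW, htB⟩ := T.exists_coord_node
  have hW : ∀ k : T.White → ℕ, ∏ e, T.coord e ^ k (T.white e) = t ^ ∑ v, k v :=
    prod_pow_eq T.white T.coord t (fun v => by convert htW v)
  have hB : ∀ k : T.Black → ℕ, ∏ e, T.coord e ^ k (T.black e) = t ^ ∑ v, k v :=
    prod_pow_eq T.black T.coord t (fun v => by convert htB v)
  have h1 : (∏ e, T.coord e ^ u e) *
      (t ^ (∑ v, (-a v).toNat) * t ^ (∑ v, (-b v).toNat)) =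
      (∏ e, T.coord e ^ v e) * (t ^ (∑ v, (a v).toNat) * t ^ (∑ v, (b v).toNat)) := by
    rw [← hW, ← hW, ← hB, ← hB]
    simp only [← Finset.prod_mul_distrib, ← pow_add]
    refine Finset.prod_congr rfl fun e _ => ?_
    have := hab e
    congr 1
    omega
  have h2 : ∑ v, (-a v).toNat + ∑ v, (-b v).toNat = ∑ v, (a v).toNat + ∑ v, (b v).toNat := by
    have ha : ∀ x : ℤ, x = x.toNat - (-x).toNat := fun x => by omega
    have h3 : ∑ v, (((a v).toNat : ℤ) - (-a v).toNat) +
        ∑ v, (((b v).toNat : ℤ) - (-b v).toNat) = 0 := by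
      simp only [← ha, hsum]
    simp only [Finset.sum_sub_distrib] at h3
    zify
    linarith
  rw [← pow_add, ← pow_add, h2] at h1
  exact (mul_cancel_right_mem_nonZeroDivisors (pow_mem ht _)).1 h1

/-! ### The homomorphism to the ring of GLSM fields -/

/-- The multidegree in the GLSM fields of a monomial in the fields `X_I`. -/
def glsmDegree (T : BraneTiling E) (u : E →₀ ℕ) : T.PerfectMatching →₀ ℕ :=
  Finsupp.equivFunOnFinite.symm fun M => ∑ e ∈ M.1, u e

theorem glsmDegree_apply (u : E →₀ ℕ) (M : T.PerfectMatching) :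
    T.glsmDegree u M = ∑ e ∈ M.1, u e := rfl

theorem monomial_eq_prod {σ : Type*} [Fintype σ] (u : σ →₀ ℕ) :
    (monomial u 1 : MvPolynomial σ ℂ) = ∏ e, X e ^ u e := by
  rw [monomial_eq, C_1, one_mul, Finsupp.prod_fintype]
  simp

theorem toGLSM_monomial (u : E →₀ ℕ) (c : ℂ) :
    T.toGLSM (monomial u c) = monomial (T.glsmDegree u) c := by
  classical
  have h1 : ∀ {σ : Type _} (v : σ →₀ ℕ), (monomial v c : MvPolynomial σ ℂ) = c • monomial v 1 := by
    intro σ v; rw [smul_monomial, smul_eq_mul, mul_one]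
  have h2 : (monomial (T.glsmDegree u) c : MvPolynomial T.PerfectMatching ℂ) =
      c • monomial (T.glsmDegree u) 1 := by rw [smul_monomial, smul_eq_mul, mul_one]
  rw [h1, h2, map_smul, monomial_eq_prod, monomial_eq_prod, map_prod]
  congr 1
  simp only [map_pow, toGLSM, aeval_X, Finset.prod_filter, ← Finset.prod_pow]
  rw [Finset.prod_comm]
  refine Finset.prod_congr rfl fun M _ => ?_
  rw [glsmDegree_apply, ← Finset.prod_pow_eq_pow_sum]
  simp [ite_pow, Finset.prod_ite_mem]

theorem toGLSM_X_ne_zero (e : E) : T.toGLSM (X e) ≠ 0 := by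
  rw [X, toGLSM_monomial]
  simp

-- Each matching has exactly one edge at a node, so every GLSM field occurs once in the image of a
-- node product.
open Classical in
theorem toGLSM_prod_eq (p : E → Prop) (h : ∀ M : T.PerfectMatching, ∃! e, e ∈ M.1 ∧ p e) :
    T.toGLSM (∏ f with p f, X f) = ∏ M, X M := by
  have h1 : (∏ f with p f, X f : MvPolynomial E ℂ) =
      monomial (Finsupp.equivFunOnFinite.symm fun f => if p f then 1 else 0) 1 := by
    rw [monomial_eq_prod, Finset.prod_filter]
    refine Finset.prod_congr rfl fun e _ => ?_
    by_cases hp : p e <;> simp [hp]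
  rw [h1, toGLSM_monomial, monomial_eq_prod]
  refine Finset.prod_congr rfl fun M _ => ?_
  have h2 : T.glsmDegree (Finsupp.equivFunOnFinite.symm fun f => if p f then 1 else 0) M = 1 := by
    rw [glsmDegree_apply]
    have h3 := BipartiteMap.sum_ind_filter M p (h M)
    have h4 := BipartiteMap.sum_ind_mul M (fun f => if p f then 1 else 0)
    simp only [mul_ite, mul_one, mul_zero, ← Finset.sum_filter] at h4
    rw [h3] at h4
    simp only [Finsupp.equivFunOnFinite_symm_apply_apply]
    rw [← Finset.sum_filter]
    exact_mod_cast h4.symm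
  rw [h2, pow_one]

theorem fTermIdeal_le_ker : T.fTermIdeal ≤ RingHom.ker T.toGLSM := by
  classical
  rw [fTermIdeal, Ideal.span_le]
  rintro _ ⟨e, rfl⟩
  have h1 := congrArg T.toGLSM (X_mul_pderiv_superpotential (T := T) e)
  rw [map_mul, map_sub, toGLSM_prod_eq _ (fun M => M.2.1 (T.white e)),
    toGLSM_prod_eq _ (fun M => M.2.2 (T.black e)), sub_self] at h1
  exact (mul_eq_zero.1 h1).resolve_left (toGLSM_X_ne_zero e)

theorem toGLSM_prod_X_pow_ne_zero (n : ℕ) : T.toGLSM ((∏ e, X e) ^ n) ≠ 0 := by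
  rw [map_pow, map_prod]
  exact pow_ne_zero _ (Finset.prod_ne_zero_iff.2 fun e _ => toGLSM_X_ne_zero e)

theorem coherentIdeal_le_ker : T.coherentIdeal ≤ RingHom.ker T.toGLSM := by
  rintro f ⟨n, hn⟩
  have h1 : T.toGLSM ((∏ e, X e) ^ n * f) = 0 := fTermIdeal_le_ker hn
  rw [map_mul] at h1
  exact (mul_eq_zero.1 h1).resolve_left (toGLSM_prod_X_pow_ne_zero n)

/-- The class of a monomial modulo the coherent ideal depends only on its GLSM degree, so the
quotient map factors linearly through `toGLSM`. -/
theorem IsConsistent.ker_toGLSM (hT : T.IsConsistent) (M₀ : T.PerfectMatching) :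
    RingHom.ker T.toGLSM = T.coherentIdeal := by
  classical
  refine le_antisymm (fun f hf => ?_) coherentIdeal_le_ker
  set q := Ideal.Quotient.mkₐ ℂ T.coherentIdeal
  -- A chosen preimage of each degree; its default value outside the range of `glsmDegree` plays no
  -- role.
  set s : (T.PerfectMatching →₀ ℕ) → (E →₀ ℕ) := Function.invFun T.glsmDegree
  set Ψ := (basisMonomials T.PerfectMatching ℂ).constr ℂ fun d => q (monomial (s d) 1)
  have hΨ : Ψ ∘ₗ T.toGLSM.toLinearMap = q.toLinearMap := by
    refine (basisMonomials E ℂ).ext fun u => ?_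
    rw [coe_basisMonomials, LinearMap.comp_apply, AlgHom.toLinearMap_apply, toGLSM_monomial,
      AlgHom.toLinearMap_apply]
    have h1 := (basisMonomials T.PerfectMatching ℂ).constr_basis ℂ
      (fun d => q (monomial (s d) 1)) (T.glsmDegree u)
    rw [coe_basisMonomials] at h1
    refine h1.trans ?_
    change _ = q (monomial u 1)
    have h2 : T.glsmDegree (s (T.glsmDegree u)) = T.glsmDegree u :=
      Function.invFun_eq ⟨u, rfl⟩
    rw [monomial_eq_prod, monomial_eq_prod]
    simp only [map_prod, map_pow]
    exact hT.prod_coord_eq M₀ fun M => DFunLike.congr_fun h2 M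
  have h1 := LinearMap.congr_fun hΨ f
  have h2 : T.toGLSM f = 0 := hf
  rw [LinearMap.comp_apply, AlgHom.toLinearMap_apply, h2, map_zero] at h1
  exact Ideal.Quotient.eq_zero_iff_mem.1 h1.symm

/-- Primality comes from the embedding in a polynomial ring. A prime between the two ideals contains
no power of the product of the `X_I`, hence contains the saturation. -/
theorem IsConsistent.coherentIdeal_mem_minimalPrimes (hT : T.IsConsistent)
    (M₀ : T.PerfectMatching) : T.coherentIdeal ∈ T.fTermIdeal.minimalPrimes := by
  refine ⟨⟨?_, fTermIdeal_le_coherentIdeal⟩, ?_⟩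
  · rw [← hT.ker_toGLSM M₀]
    exact RingHom.ker_isPrime _
  · rintro p ⟨hp, hIp⟩ hpJ f ⟨n, hn⟩
    refine (hp.mem_or_mem (hIp hn)).resolve_left fun h => ?_
    exact toGLSM_prod_X_pow_ne_zero n (coherentIdeal_le_ker (hpJ h))

/-! ### The image -/

open Classical in
/-- The deviation of the node sums from the node sums at the end points of a given edge. -/
def nodeDefect (T : BraneTiling E) (e₀ : E) :
    (E → ℤ) →ₗ[ℤ] (T.White → ℤ) × (T.Black → ℤ) where
  toFun x := (fun v => ∑ e with T.white e = v, x e - ∑ e with T.white e = T.white e₀, x e,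
    fun v => ∑ e with T.black e = v, x e - ∑ e with T.white e = T.white e₀, x e)
  map_add' x y := by
    ext v <;> simp [Finset.sum_add_distrib] <;> ring
  map_smul' c x := by
    ext v <;> simp [← Finset.mul_sum, mul_sub]

theorem exists_isRegular_of_nodeDefect (e₀ : E) {x : E → ℤ} (hx : T.nodeDefect e₀ x = 0) :
    ∃ k, T.IsRegular x k := by
  classical
  exact ⟨_, fun v => sub_eq_zero.1 (congrFun (congrArg Prod.fst hx) v),
    fun v => sub_eq_zero.1 (congrFun (congrArg Prod.snd hx) v)⟩

theorem nodeDefect_eq_zero (e₀ : E) {x : E → ℤ} {k : ℤ} (hx : T.IsRegular x k) :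
    T.nodeDefect e₀ x = 0 := by
  refine Prod.ext (funext fun v => ?_) (funext fun v => ?_)
  · exact sub_eq_zero.2 ((hx.1 v).trans (hx.1 _).symm)
  · exact sub_eq_zero.2 ((hx.2 v).trans (hx.1 _).symm)

/-- The lattice of integral functions with constant node sums is generated by the perfect matchings. -/
theorem IsConsistent.exists_eq_sum_ind (hT : T.IsConsistent) (M₀ : T.PerfectMatching) {x : E → ℤ}
    {k : ℤ} (hx : T.IsRegular x k) : ∃ c : T.PerfectMatching → ℤ, x = ∑ M, c M • M.ind := by
  classical
  obtain ⟨e₀⟩ := T.nonempty_edges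
  set N : ℤ := ∑ e, |x e|
  have hN0 : 0 ≤ N := Finset.sum_nonneg fun _ _ => abs_nonneg _
  have hreg := hx.add (BipartiteMap.IsRegular.sum Finset.univ
    fun (M : T.PerfectMatching) _ => M.isRegular_ind.smul N)
  -- Every edge lies in some matching, so adding `N` copies of all matchings makes the function
  -- nonnegative.
  set y := x + ∑ M : T.PerfectMatching, N • M.ind with hy
  have hy0 : ∀ e, 0 ≤ y e := by
    intro e
    obtain ⟨M, hM⟩ := hT.exists_mem e
    have h1 : |x e| ≤ N := Finset.single_le_sum (f := fun e => |x e|) (fun _ _ => abs_nonneg _)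
      (Finset.mem_univ e)
    have h2 : N * M.ind e ≤ ∑ M : T.PerfectMatching, N * M.ind e :=
      Finset.single_le_sum (f := fun M : T.PerfectMatching => N * M.ind e)
        (fun M _ => mul_nonneg hN0 (M.ind_nonneg e)) (Finset.mem_univ M)
    have h3 : M.ind e = 1 := by simp [BipartiteMap.PerfectMatching.ind, hM]
    have h4 := neg_abs_le (x e)
    rw [h3, mul_one] at h2
    simp only [hy, Pi.add_apply, Finset.sum_apply, Pi.smul_apply, smul_eq_mul]
    linarith
  obtain ⟨n, hn⟩ := Int.eq_ofNat_of_zero_le (by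
    rw [← hreg.1 (T.white e₀)]
    exact Finset.sum_nonneg fun e _ => hy0 e :
      0 ≤ k + ∑ M : T.PerfectMatching, N * 1)
  rw [hn] at hreg
  obtain ⟨c, hc⟩ := BipartiteMap.IsRegular.exists_eq_sum_ind M₀ n hreg hy0
  refine ⟨fun M => c M - N, ?_⟩
  simp only [sub_smul, Finset.sum_sub_distrib]
  rw [← hc, hy, add_sub_cancel_right]

/-- Integral functions on the perfect matchings that annihilate all charges come from weights on
the edges. -/
theorem IsConsistent.exists_weight (hT : T.IsConsistent) (M₀ : T.PerfectMatching)
    (a : T.PerfectMatching → ℤ) (ha : ∀ c ∈ T.fTermCharges, ∑ M, c M * a M = 0) :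
    ∃ u : E → ℤ, ∀ M : T.PerfectMatching, ∑ e ∈ M.1, u e = a M := by
  classical
  obtain ⟨e₀⟩ := T.nonempty_edges
  set L := T.nodeDefect e₀
  set P : (T.PerfectMatching → ℤ) →ₗ[ℤ] (E → ℤ) :=
    Fintype.linearCombination ℤ fun M : T.PerfectMatching => M.ind
  have hP : ∀ c, P c = ∑ M, c M • M.ind := fun c => Fintype.linearCombination_apply _ _ _
  -- Both images lie in free ℤ-modules, so the surjections onto them split. Then `id - s ∘ L`
  -- retracts onto the functions with constant node sums, which the matchings span, and `t` writes
  -- these as combinations of matchings.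
  obtain ⟨s, hs⟩ := LinearMap.exists_rightInverse_of_surjective L.rangeRestrict
    (LinearMap.range_eq_top.2 L.surjective_rangeRestrict)
  obtain ⟨t, ht⟩ := LinearMap.exists_rightInverse_of_surjective P.rangeRestrict
    (LinearMap.range_eq_top.2 P.surjective_rangeRestrict)
  have hmem : ∀ x, (LinearMap.id - s ∘ₗ L.rangeRestrict : (E → ℤ) →ₗ[ℤ] (E → ℤ)) x ∈ LinearMap.range P := by
    intro x
    have h1 : L (x - s (L.rangeRestrict x)) = 0 := by
      have h2 : L (s (L.rangeRestrict x)) = L x :=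
        congrArg Subtype.val (LinearMap.congr_fun hs (L.rangeRestrict x))
      rw [map_sub, h2, sub_self]
    obtain ⟨k, hk⟩ := exists_isRegular_of_nodeDefect e₀ h1
    obtain ⟨c, hc⟩ := hT.exists_eq_sum_ind M₀ hk
    exact ⟨c, by rw [hP, ← hc]; rfl⟩
  set A : (T.PerfectMatching → ℤ) →ₗ[ℤ] ℤ := Fintype.linearCombination ℤ a
  have hA : ∀ c, A c = ∑ M, c M * a M := fun c => Fintype.linearCombination_apply _ _ _
  set F : (E → ℤ) →ₗ[ℤ] ℤ := A ∘ₗ t ∘ₗ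
    (LinearMap.id - s ∘ₗ L.rangeRestrict).codRestrict (LinearMap.range P) hmem
  refine ⟨fun e => F (Pi.single e 1), fun M => ?_⟩
  have h1 : ∑ e ∈ M.1, F (Pi.single e 1) = F M.ind := by
    rw [← map_sum]
    congr 1
    ext e
    simp [BipartiteMap.PerfectMatching.ind, Finset.sum_apply, Pi.single_apply]
  have hLM : L.rangeRestrict M.ind = 0 :=
    Subtype.ext (nodeDefect_eq_zero e₀ M.isRegular_ind)
  have hPM : P (Pi.single M 1) = M.ind := by
    rw [hP, Finset.sum_eq_single M]
    · simp
    · intro b _ hb; simp [hb]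
    · simp
  have h2 : (LinearMap.id - s ∘ₗ L.rangeRestrict).codRestrict (LinearMap.range P) hmem M.ind =
      P.rangeRestrict (Pi.single M 1) := by
    refine Subtype.ext ?_
    simp only [LinearMap.codRestrict_apply, LinearMap.sub_apply, LinearMap.id_apply,
      LinearMap.comp_apply, hLM, map_zero, sub_zero]
    exact hPM.symm
  -- The chosen lift of `M` differs from the basis vector of `M` by a charge, on which `a` vanishes.
  set d := t (P.rangeRestrict (Pi.single M 1)) with hd
  have h3 : P (d - Pi.single M 1) = 0 := by
    have h4 : P (t (P.rangeRestrict (Pi.single M 1))) = P (Pi.single M 1) :=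
      congrArg Subtype.val (LinearMap.congr_fun ht (P.rangeRestrict (Pi.single M 1)))
    rw [map_sub, hd, h4, sub_self]
  have h5 := ha (d - Pi.single M 1) (mem_fTermCharges.2 fun e => by
    rw [hP] at h3
    simpa using congrFun h3 e)
  have h6 : A (Pi.single M 1) = a M := by
    rw [hA, Finset.sum_eq_single M]
    · simp
    · intro b _ hb; simp [hb]
    · simp
  rw [h1, ← h6, ← sub_eq_zero]
  change A (t _) - _ = 0
  rw [h2, ← map_sub, hA]
  exact h5

/-- Nonnegative integral functions on the perfect matchings that annihilate all charges come from
nonnegative weights on the edges. -/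
theorem IsConsistent.exists_nat_weight (hT : T.IsConsistent) (M₀ : T.PerfectMatching)
    (a : T.PerfectMatching → ℕ) (ha : ∀ c ∈ T.fTermCharges, ∑ M, c M * (a M : ℤ) = 0) :
    ∃ u : E → ℕ, ∀ M : T.PerfectMatching, ∑ e ∈ M.1, u e = a M := by
  classical
  obtain ⟨u, hu⟩ := hT.exists_weight M₀ (fun M => a M) ha
  obtain ⟨f, g, M, hfg, hM⟩ := BipartiteMap.exists_potential M₀ u
  obtain ⟨e₀⟩ := T.nonempty_edges
  rw [hu] at hM
  -- Subtracting the dual potential leaves nonnegative slacks but lowers every matching total by `a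
  -- M` ≥ 0; this is restored at a single white node, which each matching meets once.
  set y : E → ℤ := fun e =>
    u e - (f (T.white e) + g (T.black e)) + if T.white e = T.white e₀ then (a M : ℤ) else 0 with hy
  have hy0 : ∀ e, 0 ≤ y e := fun e => by
    have := hfg e
    simp only [hy]
    split_ifs <;> omega
  refine ⟨fun e => (y e).toNat, fun M' => ?_⟩
  zify
  simp only [Int.toNat_of_nonneg (hy0 _)]
  rw [← BipartiteMap.sum_ind_mul]
  have h1 := M'.isRegular_ind.sum_mul_white f
  have h2 := M'.isRegular_ind.sum_mul_black g
  have h3 := M'.isRegular_ind.sum_mul_white (fun v => if v = T.white e₀ then (a M : ℤ) else 0)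
  have h4 := BipartiteMap.sum_ind_mul M' u
  rw [Finset.sum_ite_eq' Finset.univ, if_pos (Finset.mem_univ _)] at h3
  rw [hu] at h4
  simp only [hy, mul_add, mul_sub, Finset.sum_add_distrib, Finset.sum_sub_distrib, h1, h2, h3, h4]
  linarith

/-- Both sides are spanned by monomials. Neutrality under the period relations extends to their
span, the lattice of all charges, and neutral exponents come from nonnegative edge weights. -/
theorem IsConsistent.range_toGLSM (hT : T.IsConsistent) (M₀ : T.PerfectMatching)
    (hM₀ : (0 : Fin 2 → ℝ) ∈ interior (T.newtonPolygon M₀)) :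
    T.toGLSM.range = T.invariants (T.periodRelations M₀) := by
  classical
  apply le_antisymm
  · rintro _ ⟨f, rfl⟩
    rw [f.as_sum]
    simp only [AlgHom.toRingHom_eq_coe, RingHom.coe_coe, map_sum, toGLSM_monomial]
    refine Subalgebra.sum_mem _ fun u _ => ?_
    intro d hd c hc
    have hd' : d = T.glsmDegree u := by
      have := support_monomial_subset hd
      simpa using this
    subst hd'
    have h1 := mem_fTermCharges.1 (periodRelations_subset M₀ hc)
    calc ∑ M, c M * (T.glsmDegree u M : ℤ) = ∑ M, ∑ e, c M * M.ind e * u e := by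
          refine Finset.sum_congr rfl fun M _ => ?_
          rw [glsmDegree_apply, Nat.cast_sum, ← BipartiteMap.sum_ind_mul M fun e => (u e : ℤ),
            Finset.mul_sum]
          exact Finset.sum_congr rfl fun e _ => by ring
      _ = 0 := by
          rw [Finset.sum_comm]
          simp only [← Finset.sum_mul, h1, zero_mul, Finset.sum_const_zero]
  · intro f hf
    rw [f.as_sum]
    refine Subalgebra.sum_mem _ fun d hd => ?_
    obtain ⟨u, hu⟩ := hT.exists_nat_weight M₀ d (fun c hc => by
      rw [← hT.span_periodRelations M₀ hM₀] at hc
      induction hc using Submodule.span_induction with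
      | mem c hc => exact hf d hd c hc
      | zero => simp
      | add x y _ _ hx hy => simp [add_mul, Finset.sum_add_distrib, hx, hy]
      | smul k x _ hx => simp [mul_assoc, ← Finset.mul_sum, hx])
    refine ⟨monomial (Finsupp.equivFunOnFinite.symm u) (f.coeff d), ?_⟩
    change T.toGLSM _ = _
    rw [toGLSM_monomial]
    rw [show T.glsmDegree (Finsupp.equivFunOnFinite.symm u) = d from Finsupp.ext hu]

end BraneTiling

/-! ### Torus integrals and the expansion of the period -/

open MeasureTheory in
theorem torusIntegrable_of_continuous {n : ℕ} {f : (Fin n → ℂ) → ℂ}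
    {c : Fin n → ℂ} {R : Fin n → ℝ} (hf : Continuous fun θ => f (torusMap c R θ)) :
    TorusIntegrable f c R :=
  hf.continuousOn.integrableOn_compact isCompact_Icc

theorem torusIntegral_congr {n : ℕ} {f g : (Fin n → ℂ) → ℂ} {c : Fin n → ℂ} {R : Fin n → ℝ}
    (h : ∀ θ, f (torusMap c R θ) = g (torusMap c R θ)) :
    torusIntegral f c R = torusIntegral g c R := by
  simp only [torusIntegral, h]

theorem torusIntegral_finset_sum {ι : Type*} {n : ℕ} (s : Finset ι) {f : ι → (Fin n → ℂ) → ℂ}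
    {c : Fin n → ℂ} {R : Fin n → ℝ} (h : ∀ i ∈ s, TorusIntegrable (f i) c R) :
    torusIntegral (fun x => ∑ i ∈ s, f i x) c R = ∑ i ∈ s, torusIntegral (f i) c R := by
  simp only [torusIntegral, Finset.smul_sum]
  exact MeasureTheory.integral_finsetSum s fun i hi => (h i hi).function_integrable

theorem norm_torusMap_zero_one {n : ℕ} (θ : Fin n → ℝ) (i : Fin n) :
    ‖torusMap 0 1 θ i‖ = 1 := by
  simp [torusMap, Complex.norm_exp_ofReal_mul_I]

theorem torusMap_zero_one_ne_zero {n : ℕ} (θ : Fin n → ℝ) (i : Fin n) : torusMap 0 1 θ i ≠ 0 := by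
  rw [← norm_ne_zero_iff, norm_torusMap_zero_one]
  exact one_ne_zero

theorem continuous_torusMap_apply {n : ℕ} (c : Fin n → ℂ) (R : Fin n → ℝ) (i : Fin n) :
    Continuous fun θ => torusMap c R θ i := by
  unfold torusMap
  fun_prop

theorem continuous_torusMap_zpow {n : ℕ} (i : Fin n) (m : ℤ) :
    Continuous fun θ => torusMap 0 1 θ i ^ m :=
  (continuous_torusMap_apply 0 1 i).zpow₀ m fun θ => Or.inl (torusMap_zero_one_ne_zero θ i)

theorem circleIntegral_zpow (m : ℤ) :
    (∮ z in C(0, 1), z ^ m) = if m = -1 then 2 * π * Complex.I else 0 := by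
  split_ifs with h
  · subst h
    have := circleIntegral.integral_sub_center_inv 0 (one_ne_zero (α := ℝ))
    simpa using this
  · have := circleIntegral.integral_sub_zpow_of_ne h 0 0 1
    simpa using this

theorem torusIntegral_zpow_mul_zpow (m n : ℤ) :
    torusIntegral (fun x : Fin 2 → ℂ => x 0 ^ m * x 1 ^ n) 0 1 =
      if m = -1 ∧ n = -1 then (2 * π * Complex.I) ^ 2 else 0 := by
  rw [torusIntegral_succ (torusIntegrable_of_continuous
    ((continuous_torusMap_zpow 0 m).mul (continuous_torusMap_zpow 1 n)))]
  simp only [torusIntegral_dim1]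
  have h1 : ∀ x : ℂ, (∮ z in C(0, 1), x ^ m * z ^ n) =
      (if n = -1 then 2 * π * Complex.I else 0) * x ^ m := fun x => by
    rw [circleIntegral.integral_const_mul, circleIntegral_zpow, mul_comm]
  change (∮ x in C(0, 1), (∮ z in C(0, 1), x ^ m * z ^ n)) = _
  simp only [h1]
  rw [circleIntegral.integral_const_mul, circleIntegral_zpow]
  by_cases hm : m = -1 <;> by_cases hn : n = -1 <;> simp [hm, hn, sq]

namespace BraneTiling

variable {E : Type*} [Fintype E] {T : BraneTiling E}

open Classical in
theorem aeval_coeff (M₀ : T.PerfectMatching) (n : ℕ) (r : T.RMatching M₀ → ℂ) :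
    MvPolynomial.aeval r (T.coeff M₀ n) =
      ∑ l ∈ Finset.piAntidiag (Finset.univ : Finset (T.RMatching M₀)) n,
        if ∑ i, (l i : ℤ) • T.height M₀ i.1 = 0 then
          (Nat.multinomial Finset.univ l : ℂ) * ∏ i, r i ^ l i else 0 := by
  have hM : ∀ l : T.RMatching M₀ → ℕ, T.latticeMatrix M₀ *ᵥ (fun i => (l i : ℤ)) =
      ∑ i : T.RMatching M₀, (l i : ℤ) • T.height M₀ i.1 := by
    intro l
    ext j
    simp [Matrix.mulVec, dotProduct, latticeMatrix, mul_comm]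
  rw [coeff, map_sum, Finset.sum_filter]
  refine Finset.sum_nbij' (fun l => ⇑l) (fun l => Finsupp.equivFunOnFinite.symm l) ?_ ?_ ?_ ?_ ?_
  · intro l hl
    simpa using hl
  · intro l hl
    simpa using hl
  · intro l _
    ext; rfl
  · intro l _
    rfl
  · intro l hl
    simp only [hM]
    split_ifs
    · rw [MvPolynomial.aeval_monomial, Finsupp.prod_fintype _ _ (by simp)]
      have : ∑ i, l i = n := by simpa using hl
      rw [Nat.multinomial, this, algebraMap_int_eq, eq_intCast, Int.cast_natCast]
    · rfl

theorem continuous_newton_torusMap (M₀ : T.PerfectMatching) (r : T.RMatching M₀ → ℂ) :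
    Continuous fun θ => T.newton M₀ r (torusMap 0 1 θ) := by
  unfold newton
  exact continuous_finsetSum _ fun i _ => continuous_const.mul
    ((continuous_torusMap_zpow 0 _).mul (continuous_torusMap_zpow 1 _))

/-- The constant term of the `n`-th power of the Newton polynomial. -/
theorem torusIntegral_newton_pow (M₀ : T.PerfectMatching) (r : T.RMatching M₀ → ℂ) (n : ℕ) :
    torusIntegral (fun x => T.newton M₀ r x ^ n * (1 / x 0) * (1 / x 1)) 0 1 =
      (2 * π * Complex.I) ^ 2 * MvPolynomial.aeval r (T.coeff M₀ n) := by
  classical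
  have h1 : ∀ θ : Fin 2 → ℝ, T.newton M₀ r (torusMap 0 1 θ) ^ n * (1 / torusMap 0 1 θ 0) *
      (1 / torusMap 0 1 θ 1) =
      ∑ l ∈ Finset.piAntidiag (Finset.univ : Finset (T.RMatching M₀)) n,
        (Nat.multinomial Finset.univ l * ∏ i, r i ^ l i) *
          (torusMap 0 1 θ 0 ^ ((∑ i, (l i : ℤ) • T.height M₀ i.1) 0 - 1) *
            torusMap 0 1 θ 1 ^ ((∑ i, (l i : ℤ) • T.height M₀ i.1) 1 - 1)) := by
    intro θ
    have hx := torusMap_zero_one_ne_zero θ 0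
    have hy := torusMap_zero_one_ne_zero θ 1
    set x := torusMap 0 1 θ 0
    set y := torusMap 0 1 θ 1
    have hz : ∀ (z : ℂ), z ≠ 0 → ∀ f : T.RMatching M₀ → ℤ, z ^ (∑ i, f i) = ∏ i, z ^ f i := by
      intro z hz f
      induction (Finset.univ : Finset (T.RMatching M₀)) using Finset.induction_on with
      | empty => simp
      | insert i s hi ih => rw [Finset.sum_insert hi, Finset.prod_insert hi, zpow_add₀ hz, ih]
    rw [newton, Finset.sum_pow_eq_sum_piAntidiag, Finset.sum_mul, Finset.sum_mul]
    refine Finset.sum_congr rfl fun l _ => ?_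
    rw [zpow_sub_one₀ hx, zpow_sub_one₀ hy, Finset.sum_apply, Finset.sum_apply, hz x hx, hz y hy]
    simp only [mul_pow, Finset.prod_mul_distrib, Pi.smul_apply, smul_eq_mul, one_div]
    have hp : ∀ (z : ℂ) (k : ℕ) (m : ℤ), z ^ ((k : ℤ) * m) = (z ^ m) ^ k := fun z k m => by
      rw [mul_comm, zpow_mul, zpow_natCast]
    simp only [hp]
    ring
  rw [torusIntegral_congr (g := fun x => ∑ l ∈ Finset.piAntidiag
        (Finset.univ : Finset (T.RMatching M₀)) n,
        (Nat.multinomial Finset.univ l * ∏ i, r i ^ l i) *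
          (x 0 ^ ((∑ i, (l i : ℤ) • T.height M₀ i.1) 0 - 1) *
            x 1 ^ ((∑ i, (l i : ℤ) • T.height M₀ i.1) 1 - 1))) h1,
    torusIntegral_finset_sum _ fun l _ => torusIntegrable_of_continuous (continuous_const.mul
      ((continuous_torusMap_zpow 0 _).mul (continuous_torusMap_zpow 1 _))), aeval_coeff,
    Finset.mul_sum]
  refine Finset.sum_congr rfl fun l _ => ?_
  rw [torusIntegral_const_mul, torusIntegral_zpow_mul_zpow]
  -- The factors 1/z and 1/w shift the exponents by -1, so the surviving terms are those of total
  -- height zero.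
  have h2 : (∑ i, (l i : ℤ) • T.height M₀ i.1) = 0 ↔
      (∑ i, (l i : ℤ) • T.height M₀ i.1) 0 - 1 = -1 ∧
        (∑ i, (l i : ℤ) • T.height M₀ i.1) 1 - 1 = -1 := by
    rw [funext_iff, Fin.forall_fin_two]
    simp only [Pi.zero_apply]
    omega
  simp only [h2]
  split_ifs
  · ring
  · simp

open MeasureTheory in
theorem hasSum_period (M₀ : T.PerfectMatching) (r : T.RMatching M₀ → ℂ) (k : ℂ)
    (hk : ∀ x : Fin 2 → ℂ, (∀ j, ‖x j‖ = 1) → ‖T.newton M₀ r x‖ < ‖k‖) :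
    HasSum (fun n : ℕ => MvPolynomial.aeval r (T.coeff M₀ n) / k ^ n) (T.period M₀ r k) := by
  have hk0 : 0 < ‖k‖ := (norm_nonneg _).trans_lt (hk 1 (by simp))
  have hk0' : k ≠ 0 := norm_pos_iff.1 hk0
  have hcont := continuous_newton_torusMap M₀ r
  -- Compactness turns the pointwise bound |p| < |k| into a uniform ratio q < 1, and q ^ n dominates
  -- the integrands.
  obtain ⟨θ₀, -, hmax⟩ := (isCompact_Icc (a := (0 : Fin 2 → ℝ)) (b := fun _ => 2 * π)).exists_isMaxOn
    ⟨0, le_refl _, fun _ => Real.two_pi_pos.le⟩ hcont.norm.continuousOn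
  set q : ℝ := ‖k⁻¹ * T.newton M₀ r (torusMap 0 1 θ₀)‖ with hq
  have hq1 : q < 1 := by
    rw [hq, norm_mul, norm_inv, inv_mul_lt_one₀ hk0]
    exact hk _ (norm_torusMap_zero_one θ₀)
  have hq0 : 0 ≤ q := norm_nonneg _
  have hle : ∀ θ ∈ Set.Icc (0 : Fin 2 → ℝ) fun _ => 2 * π,
      ‖k⁻¹ * T.newton M₀ r (torusMap 0 1 θ)‖ ≤ q := by
    intro θ hθ
    rw [hq, norm_mul, norm_mul]
    exact mul_le_mul_of_nonneg_left (hmax hθ) (norm_nonneg _)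
  have hmem : ∀ᵐ θ ∂(volume.restrict (Set.Icc (0 : Fin 2 → ℝ) fun _ => 2 * π)),
      θ ∈ Set.Icc (0 : Fin 2 → ℝ) fun _ => 2 * π := ae_restrict_mem measurableSet_Icc
  set J : (Fin 2 → ℝ) → ℂ := fun θ =>
    ∏ i, ((1 : Fin 2 → ℝ) i : ℂ) * Complex.exp (θ i * Complex.I) * Complex.I with hJ
  have hJc : Continuous J := by
    simp only [hJ]
    fun_prop
  have hJn : ∀ θ, ‖J θ‖ = 1 := fun θ => by
    simp [hJ, Complex.norm_exp_ofReal_mul_I]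
  have hinv : ∀ i, Continuous fun θ : Fin 2 → ℝ => 1 / torusMap 0 1 θ i := fun i =>
    continuous_const.div (continuous_torusMap_apply 0 1 i) fun θ => torusMap_zero_one_ne_zero θ i
  have hsum := hasSum_integral_of_dominated_convergence
    (μ := volume.restrict (Set.Icc (0 : Fin 2 → ℝ) fun _ => 2 * π))
    (F := fun (n : ℕ) θ => J θ • ((k⁻¹ * T.newton M₀ r (torusMap 0 1 θ)) ^ n *
      (1 / torusMap 0 1 θ 0) * (1 / torusMap 0 1 θ 1)))
    (f := fun θ => J θ • (1 / (1 - k⁻¹ * T.newton M₀ r (torusMap 0 1 θ)) *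
      (1 / torusMap 0 1 θ 0) * (1 / torusMap 0 1 θ 1)))
    (fun n _ => q ^ n)
    (fun n => (hJc.smul ((((continuous_const.mul hcont).pow n).mul (hinv 0)).mul
      (hinv 1))).aestronglyMeasurable)
    (fun n => by
      filter_upwards [hmem] with θ hθ
      rw [norm_smul, hJn, norm_mul, norm_mul, norm_div, norm_div, norm_torusMap_zero_one,
        norm_torusMap_zero_one, norm_one, norm_pow, one_mul, div_one, mul_one, mul_one]
      exact pow_le_pow_left₀ (norm_nonneg _) (hle θ hθ) n)
    (Filter.Eventually.of_forall fun _ => summable_geometric_of_lt_one hq0 hq1)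
    (by
      have : IsFiniteMeasure (volume.restrict (Set.Icc (0 : Fin 2 → ℝ) fun _ => 2 * π)) :=
        ⟨by simpa using isCompact_Icc.measure_lt_top⟩
      exact integrable_const _)
    (by
      filter_upwards [hmem] with θ hθ
      refine HasSum.const_smul _ (HasSum.mul_right _ (HasSum.mul_right _ ?_))
      rw [one_div]
      exact hasSum_geometric_of_norm_lt_one ((hle θ hθ).trans_lt hq1))
  have hπ : (2 * π * Complex.I) ^ 2 ≠ 0 :=
    pow_ne_zero _ (by simp [Real.pi_ne_zero])
  have h1 : HasSum _ (T.period M₀ r k) := hsum.mul_left (1 / (2 * π * Complex.I) ^ 2)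
  convert h1 using 1
  funext n
  have h2 : torusIntegral (fun x => k⁻¹ ^ n * (T.newton M₀ r x ^ n * (1 / x 0) * (1 / x 1))) 0 1 =
      ∫ θ in Set.Icc (0 : Fin 2 → ℝ) fun _ => 2 * π,
        J θ • ((k⁻¹ * T.newton M₀ r (torusMap 0 1 θ)) ^ n *
          (1 / torusMap 0 1 θ 0) * (1 / torusMap 0 1 θ 1)) := by
    rw [torusIntegral]
    simp only [mul_pow, mul_assoc, hJ]
  rw [← h2, torusIntegral_const_mul, torusIntegral_newton_pow, inv_pow]
  field_simp

theorem coeff_zero (M₀ : T.PerfectMatching) : T.coeff M₀ 0 = 1 := by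
  classical
  have : (Matrix.mulVec (T.latticeMatrix M₀) fun _ => 0) = 0 := Matrix.mulVec_zero _
  rw [coeff, Finset.finsuppAntidiag_zero, Finset.sum_filter]
  simp [this]

/-- A monomial of degree one is a single `r`-matching, whose height is nonzero. -/
theorem coeff_one (M₀ : T.PerfectMatching) : T.coeff M₀ 1 = 0 := by
  rw [← MvPolynomial.support_eq_empty, Finset.eq_empty_iff_forall_notMem]
  intro l hl
  obtain ⟨h1, h2⟩ := (coeff_support_iff M₀ 1 l).1 hl
  have hne : ∃ i, l i ≠ 0 := by
    by_contra! h
    simp [h] at h1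
  obtain ⟨i, hi⟩ := hne
  have hz : ∀ j, j ≠ i → l j = 0 := fun j hj => by
    classical
    have h3 := Finset.sum_le_sum_of_subset (f := l) (Finset.subset_univ {i, j})
    rw [Finset.sum_pair hj.symm, h1] at h3
    omega
  have hi1 : l i = 1 := by
    rwa [Finset.sum_eq_single i (fun j _ hj => hz j hj) (by simp)] at h1
  rw [Finset.sum_eq_single i (fun j _ hj => by simp [hz j hj]) (by simp), hi1] at h2
  exact i.2 (by simpa using h2)

theorem hasSum_period_sub_one (M₀ : T.PerfectMatching) (r : T.RMatching M₀ → ℂ) (k : ℂ)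
    (hk : ∀ x : Fin 2 → ℂ, (∀ j, ‖x j‖ = 1) → ‖T.newton M₀ r x‖ < ‖k‖) :
    HasSum (fun n : ℕ => MvPolynomial.aeval r (T.coeff M₀ (n + 2)) / k ^ (n + 2))
      (T.period M₀ r k - 1) := by
  have := (hasSum_nat_add_iff' 2).2 (hasSum_period M₀ r k hk)
  simpa [Finset.sum_range_succ, coeff_zero, coeff_one] using this

end BraneTiling

end

theorem proposition3p3 {E : Type*} [Fintype E] (T : BraneTiling E) (hT : T.IsConsistent)
    (M₀ : T.PerfectMatching) (hM₀ : (0 : Fin 2 → ℝ) ∈ interior (T.newtonPolygon M₀)) :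
    -- the expansion of the period
    (T.coeff M₀ 0 = 1 ∧ T.coeff M₀ 1 = 0 ∧
      ∀ (r : T.RMatching M₀ → ℂ) (k : ℂ),
        (∀ x : Fin 2 → ℂ, (∀ j, ‖x j‖ = 1) → ‖T.newton M₀ r x‖ < ‖k‖) →
        HasSum (fun n : ℕ => MvPolynomial.aeval r (T.coeff M₀ (n + 2)) / k ^ (n + 2))
          (T.period M₀ r k - 1)) ∧
    -- each monomial of `f_n` gives a relation between `r`- and `s`-matchings
    (∀ (n : ℕ) (l : T.RMatching M₀ →₀ ℕ), l ∈ (T.coeff M₀ n).support →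
      ∃ l' : T.SMatching M₀ → ℕ, ∑ j, l' j = n ∧ T.Regroups M₀ l l') ∧
    -- these relations generate all relations in `Q_F`
    Submodule.span ℤ (T.periodRelations M₀) = T.fTermCharges ∧
    -- the coherent component of the master space is the quotient of the space of GLSM fields
    -- by the charges read off from the period
    T.coherentIdeal ∈ T.fTermIdeal.minimalPrimes ∧
    RingHom.ker T.toGLSM = T.coherentIdeal ∧
    T.toGLSM.range = T.invariants (T.periodRelations M₀) := by
  exact ⟨⟨BraneTiling.coeff_zero M₀, BraneTiling.coeff_one M₀, BraneTiling.hasSum_period_sub_one M₀⟩,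
    BraneTiling.exists_regroups M₀, hT.span_periodRelations M₀ hM₀,
    hT.coherentIdeal_mem_minimalPrimes M₀, hT.ker_toGLSM M₀, hT.range_toGLSM M₀ hM₀⟩
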